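/- Throughout, graphs are finite and simple, and a rooted graph $(G,i)$ is a graph $G$ with a designated root vertex $i$ (rooted graphs are considered up to isomorphism). For a graph $G$ on $n$ vertices, let $\mathcal{S}(G)$ be the set of real symmetric $n\times n$ matrices whose off-diagonal $(a,b)$-entry is nonzero if and only if $\{a,b\}$ is an edge of $G$ (the diagonal is arbitrary). For $A\in\mathcal{S}(G)$, let $A(i)$ be obtained from $A$ by deleting row and column $i$; the $i$-nullity pair of $A$ is $(\operatorname{null}(A),\operatorname{null}(A(i)))$. The matrix $A$ has the $i$-strong nullity interlacing property ($i$-SNIP) if $X=O$ is the only real symmetric matrix such that $A\circ X=I\circ X=O$ (entrywise products) and all rows of $AX$ except possibly the $i$-th are zero. Let $\xi\xi(G,i)$ be the maximum of $k+\ell$ over all pairs $k\le\ell$ such that some $A\in\mathcal{S}(G)$ with $i$-SNIP has $i$-nullity pair $(k,\ell)$. A proper rooted minor of $(G,i)$ is a rooted graph obtained from $(G,i)$ by one or more of the following operations: removing an edge, removing a vertex that is not the root, or contracting an edge (discarding loops and merging parallel edges), where the new vertex becomes the root if the contracted edge is incident to the root. A rooted graph $(G,i)$ is a minimal minor for $\xi\xi\ge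 s$ if $\xi\xi(G,i)\ge s$ and every proper rooted minor $(F,r)$ of $(G,i)$ satisfies $\xi\xi(F,r)<s$. A rooted graph $(G,i)$ is obtained from $(H,j)$ by extending the root if $G$ is obtained from $H$ by adding a new vertex $i$ adjacent only to $j$, and $i$ is made the root. Theorem. For each integer $k\ge 0$, the minimal minors for $\xi\xi\ge 2k+1$ are exactly the rooted graphs obtained from the minimal minors for $\xi\xi\ge 2k$ by extending their roots. -/

import Mathlib

universe u

/-- A (finite) rooted graph: a finite simple graph with a designated root vertex. -/
structure RootedGraph where
  V : Type u
  [fintype : Fintype V]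
  graph : SimpleGraph V
  root : V

attribute [instance] RootedGraph.fintype

/-- The nullity of a real square matrix: the dimension of its kernel. -/
noncomputable def nullity {V : Type*} [Fintype V] (A : Matrix V V ℝ) : ℕ :=
  Module.finrank ℝ (LinearMap.ker A.mulVecLin)

/-- `A(i)`: the principal submatrix obtained by removing row and column `i`. -/
def deleteIndex {V : Type*} (A : Matrix V V ℝ) (i : V) :
    Matrix {v // v ≠ i} {v // v ≠ i} ℝ :=
  A.submatrix Subtype.val Subtype.val

/-- The matrices associated to `G`: real symmetric, with the off-diagonal `(a, b)`-entry nonzero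
if and only if `a` and `b` are adjacent; the diagonal is arbitrary. -/
def IsGraphMatrix {V : Type*} (G : SimpleGraph V) (A : Matrix V V ℝ) : Prop :=
  A.IsSymm ∧ ∀ a b, a ≠ b → (A a b ≠ 0 ↔ G.Adj a b)

open Classical in
/-- The `i`-strong nullity interlacing property: `X = 0` is the only symmetric matrix with
`A ∘ X = I ∘ X = 0` such that `A X` vanishes once its `i`-th row is removed. -/
def HasSNIP {V : Type*} [Fintype V] (A : Matrix V V ℝ) (i : V) : Prop :=
  ∀ X : Matrix V V ℝ, X.IsSymm → Matrix.hadamard A X = 0 →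
    Matrix.hadamard (1 : Matrix V V ℝ) X = 0 →
    (A * X).submatrix (Subtype.val : {v // v ≠ i} → V) id = 0 → X = 0

namespace RootedGraph

open Classical in
/-- The rooted graph allows the nullity pair `(k, l)` with the strong nullity interlacing
property at its root. -/
def AllowsSNIP (R : RootedGraph.{u}) (k l : ℕ) : Prop :=
  ∃ A : Matrix R.V R.V ℝ, IsGraphMatrix R.graph A ∧ nullity A = k ∧
    nullity (deleteIndex A R.root) = l ∧ HasSNIP A R.root

/-- The sums `k + l` over the pairs `k ≤ l` that the rooted graph allows with SNIP. -/
def pairSums (R : RootedGraph.{u}) : Set ℕ :=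
  {s | ∃ k l, k ≤ l ∧ R.AllowsSNIP k l ∧ s = k + l}

/-- The parameter `ξξ(G, i)`, the maximum of `k + l` over the pairs `k ≤ l` that `(G, i)` allows
with SNIP. The maximum is attained: see `isGreatest_xixi`. -/
noncomputable def xixi (R : RootedGraph.{u}) : ℕ := sSup R.pairSums

theorem pairSums_bddAbove (R : RootedGraph.{u}) : BddAbove R.pairSums := by
  classical
  refine ⟨Fintype.card R.V + Fintype.card R.V, ?_⟩
  rintro s ⟨k, l, -, ⟨A, -, rfl, rfl, -⟩, rfl⟩
  have h1 : nullity A ≤ Fintype.card R.V :=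
    (Submodule.finrank_le _).trans (by simp)
  have h2 : nullity (deleteIndex A R.root) ≤ Fintype.card {v // v ≠ R.root} :=
    (Submodule.finrank_le _).trans (by simp)
  have h3 : Fintype.card {v // v ≠ R.root} ≤ Fintype.card R.V := Fintype.card_subtype_le _
  omega

theorem allowsSNIP_zero_zero (R : RootedGraph.{u}) : R.AllowsSNIP 0 0 := by
  classical
  have hpos : ((R.graph.lapMatrix ℝ + 1 : Matrix R.V R.V ℝ)).PosDef :=
    Matrix.PosDef.posSemidef_add (SimpleGraph.posSemidef_lapMatrix ℝ R.graph) Matrix.PosDef.one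
  have hnull : ∀ {W : Type u} [Fintype W] (B : Matrix W W ℝ), B.PosDef → nullity B = 0 := by
    intro W _ B hB
    have : LinearMap.ker B.mulVecLin = ⊥ := by
      rw [Matrix.ker_mulVecLin_eq_bot_iff]
      intro v hv
      by_contra hne
      have := hB.dotProduct_mulVec_pos hne
      simp [hv] at this
    unfold nullity
    rw [this]; simp
  set A := (R.graph.lapMatrix ℝ + 1 : Matrix R.V R.V ℝ) with hA
  have hsymm : A.IsSymm := (SimpleGraph.isSymm_lapMatrix ℝ R.graph).add Matrix.isSymm_one
  refine ⟨A, ⟨hsymm, ?_⟩, hnull A hpos, ?_, ?_⟩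
  · intro a b hab
    simp [hA, SimpleGraph.lapMatrix, SimpleGraph.degMatrix,
      SimpleGraph.adjMatrix_apply, hab]
  · exact hnull _ (hpos.submatrix Subtype.val_injective)
  · intro X hX _ hdiag hrow
    have hx : ∀ v b, v ≠ R.root → (A * X) v b = 0 := fun v b hv =>
      congrFun (congrFun hrow ⟨v, hv⟩) b
    have hd : X R.root R.root = 0 := by
      have := congrFun (congrFun hdiag R.root) R.root
      simpa using this
    have key : ∀ a b, (X * (A * X)) a b = X a R.root * (A * X) R.root b := by
      intro a b
      rw [Matrix.mul_apply, Finset.sum_eq_single R.root]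
      · intro v _ hv; rw [hx v b hv, mul_zero]
      · simp
    have hsq : ∀ b, X R.root b = 0 → ∀ a, X a b = 0 := by
      intro b hb a
      by_contra hne
      have hc : (fun c => X c b) ≠ 0 := fun h => hne (congrFun h a)
      have h1 := hpos.dotProduct_mulVec_pos hc
      have h2 : star (fun c => X c b) ⬝ᵥ A.mulVec (fun c => X c b) = (X * (A * X)) b b := by
        rw [Matrix.mul_apply]
        refine Finset.sum_congr rfl fun c _ => ?_
        rw [← hX.apply b c]
        rfl
      rw [h2, key, hX.apply, hb, zero_mul] at h1
      exact lt_irrefl _ h1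
    have hroot : ∀ b, X R.root b = 0 := by
      intro b
      rw [← hX.apply]
      exact hsq _ hd b
    ext a b
    exact hsq b (hroot b) a

theorem isGreatest_xixi (R : RootedGraph.{u}) : IsGreatest R.pairSums R.xixi :=
  ⟨Nat.sSup_mem ⟨0, 0, 0, le_rfl, R.allowsSNIP_zero_zero, rfl⟩ R.pairSums_bddAbove,
    fun _ hs => le_csSup R.pairSums_bddAbove hs⟩

/-- Isomorphism of rooted graphs. -/
def IsIso (R S : RootedGraph.{u}) : Prop :=
  ∃ e : R.graph ≃g S.graph, e R.root = S.root

/-- `Step R S`: up to isomorphism, `S` is obtained from `R` by one operation, namely removing an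
edge, removing a vertex that is not the root, or contracting an edge `ab` of `R`. In the last case
`f` is the contraction map: it identifies exactly `a` with `b`, the adjacencies of `S` are the
images of those of `R` (loops dropped, parallel edges merged), and the root goes to the root. -/
inductive Step : RootedGraph.{u} → RootedGraph.{u} → Prop
  | deleteEdge {R S : RootedGraph.{u}} (a b : R.V) (hab : R.graph.Adj a b)
      (e : S.graph ≃g R.graph.deleteEdges {s(a, b)}) (he : e S.root = R.root) : Step R S
  | deleteVertex {R S : RootedGraph.{u}} (v : R.V) (hv : v ≠ R.root)
      (e : S.graph ≃g R.graph.induce {w | w ≠ v}) (he : (e S.root : R.V) = R.root) : Step R S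
  | contractEdge {R S : RootedGraph.{u}} (a b : R.V) (hab : R.graph.Adj a b)
      (f : R.V → S.V) (hf : Function.Surjective f)
      (hfib : ∀ x y, f x = f y ↔ x = y ∨ (x = a ∧ y = b) ∨ (x = b ∧ y = a))
      (hadj : ∀ x y, S.graph.Adj x y ↔ x ≠ y ∧ ∃ p q, f p = x ∧ f q = y ∧ R.graph.Adj p q)
      (hroot : f R.root = S.root) : Step R S

/-- `S` is a proper rooted minor of `R`: it is obtained from `R` by one or more operations. -/
def IsProperMinor (S R : RootedGraph.{u}) : Prop := Relation.TransGen Step R S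

/-- `R` is a minimal minor for `ξξ ≥ s`. -/
def IsMinimalMinor (R : RootedGraph.{u}) (s : ℕ) : Prop :=
  s ≤ R.xixi ∧ ∀ S : RootedGraph.{u}, S.IsProperMinor R → S.xixi < s

/-- Extending the root: append a new leaf (`none`) to the root and make it the new root. -/
def extendRoot (R : RootedGraph.{u}) : RootedGraph.{u} where
  V := Option R.V
  graph := R.graph.map some ⊔ SimpleGraph.edge none (some R.root)
  root := none

end RootedGraph

/-! Write a matrix of the rooted graph as a border `(a, b)` around a block `C`, with the root as the
bordering index. Deleting the root gives `C`, and the nullity drops by one, stays or grows by one,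
according to whether `b` lies in the range of `C` and whether the Schur complement vanishes. Hence a
pair `k ≤ l` is `(k, k)` or `(k, k + 1)`.

Both kinds of pair reduce to the strong Arnold property (SAP). The pair `(k, k + 1)` is allowed iff
the graph without its root has a SAP matrix of nullity `k + 1` with a kernel vector nonzero at some
neighbor of the root (`allowsBorder_succ_iff`). The pair `(k, k)` is allowed iff the whole graph has
a SAP matrix of nullity `k + 1` with a kernel vector nonzero at the root
(`RootSplit.allowsBorder_self_iff`). When the root is a leaf attached to `j`, the first condition is
the second one for the graph rooted at `j`, so extending the root turns `(k, k)` into `(k, k + 1)`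
and back.

The analytic step is `AllowsBorder.step_down`: `(k + 1, k + 1)` allowed implies `(k, k + 1)`
allowed, by a perturbation whose derivative is surjective because of SNIP. So `ξξ ≥ 2k + 1` iff some
`(m, m + 1)` with `m ≥ k` is allowed.

It remains to compare minors. A graph allowing `(m, m + 1)` contains, after deleting all root edges
but one, the root extension of a graph allowing `(m, m)`. A proper minor of a root extension is the
extension of a proper minor, or a minor of the original graph, or has an isolated root, and then
allows no `(m, m + 1)`. Monotonicity of `ξξ` under minors is never needed. -/

open Matrix

/-! ### Nullities and the Fredholm alternative. -/

section Nullity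

variable {V W : Type*} [Fintype V] [Fintype W]

theorem finrank_le_of_mapsTo {E F : Type*} [AddCommGroup E] [Module ℝ E] [AddCommGroup F]
    [Module ℝ F] [FiniteDimensional ℝ F] (f : E →ₗ[ℝ] F) (P : Submodule ℝ E) (Q : Submodule ℝ F)
    (hPQ : ∀ x ∈ P, f x ∈ Q) (hinj : ∀ x ∈ P, f x = 0 → x = 0) :
    Module.finrank ℝ P ≤ Module.finrank ℝ Q := by
  refine LinearMap.finrank_le_finrank_of_injective (f := f.restrict hPQ) ?_
  rw [← LinearMap.ker_eq_bot, LinearMap.ker_eq_bot']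
  rintro ⟨x, hx⟩ h
  have : f x = 0 := congrArg Subtype.val h
  exact Subtype.ext (hinj x hx this)

theorem nullity_le_of_mapsTo (A : Matrix V V ℝ) (B : Matrix W W ℝ)
    (f : (V → ℝ) →ₗ[ℝ] (W → ℝ)) (hAB : ∀ x, A *ᵥ x = 0 → B *ᵥ (f x) = 0)
    (hinj : ∀ x, A *ᵥ x = 0 → f x = 0 → x = 0) : nullity A ≤ nullity B :=
  finrank_le_of_mapsTo f _ _ (fun x hx => by simpa using hAB x (by simpa using hx))
    fun x hx => hinj x (by simpa using hx)

theorem finrank_ker_inf_ker_add_one (A : Matrix V V ℝ) (φ : (V → ℝ) →ₗ[ℝ] ℝ) {x : V → ℝ}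
    (hx : A *ᵥ x = 0) (hφ : φ x ≠ 0) :
    Module.finrank ℝ (LinearMap.ker A.mulVecLin ⊓ LinearMap.ker φ : Submodule ℝ (V → ℝ)) + 1 =
      nullity A := by
  have hne : φ.domRestrict (LinearMap.ker A.mulVecLin) ≠ 0 := fun h =>
    hφ (LinearMap.congr_fun h ⟨x, by simpa using hx⟩)
  have h := Module.Dual.finrank_ker_add_one_of_ne_zero (f := φ.domRestrict _) hne
  rw [nullity, ← h]
  congr 1
  refine le_antisymm ?_ ?_
  · refine LinearMap.finrank_le_finrank_of_injective
      (f := (Submodule.inclusion (inf_le_left :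
        LinearMap.ker A.mulVecLin ⊓ LinearMap.ker φ ≤ _)).codRestrict _ ?_) ?_
    · rintro ⟨y, hy⟩
      simpa using hy.2
    · intro y z hyz
      have := congrArg (fun t => (t : LinearMap.ker A.mulVecLin).1) (congrArg Subtype.val hyz)
      exact Subtype.ext this
  · refine finrank_le_of_mapsTo (LinearMap.ker A.mulVecLin).subtype _ _ ?_ ?_
    · rintro ⟨y, hy⟩ hz
      exact ⟨hy, hz⟩
    · rintro ⟨y, hy⟩ hz h
      exact Subtype.ext h

theorem nullity_add_rank (A : Matrix V V ℝ) : A.rank + nullity A = Fintype.card V := by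
  have := LinearMap.finrank_range_add_finrank_ker A.mulVecLin
  rwa [Module.finrank_fintype_fun_eq_card] at this

theorem nullity_submatrix (A : Matrix W W ℝ) (e : V ≃ W) :
    nullity (A.submatrix e e) = nullity A := by
  have h1 := nullity_add_rank (A.submatrix e e)
  have h2 := nullity_add_rank A
  rw [rank_submatrix, Fintype.card_congr e] at h1
  omega

theorem Matrix.IsSymm.mulVec_dotProduct {C : Matrix W W ℝ} (hC : C.IsSymm) (x y : W → ℝ) :
    (C *ᵥ x) ⬝ᵥ y = x ⬝ᵥ (C *ᵥ y) := by
  rw [dotProduct_mulVec, ← mulVec_transpose, hC.eq]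

/-- Fredholm alternative: a functional vanishing on the range of `C` but not at `b` is the dot
product with a vector, which symmetry puts in the kernel. -/
theorem exists_mulVec_eq_or (C : Matrix W W ℝ) (hC : C.IsSymm) (b : W → ℝ) :
    (∃ y, C *ᵥ y = b) ∨ ∃ w, C *ᵥ w = 0 ∧ b ⬝ᵥ w ≠ 0 := by
  classical
  by_cases h : b ∈ LinearMap.range C.mulVecLin
  · obtain ⟨y, hy⟩ := h
    exact Or.inl ⟨y, by simpa using hy⟩
  · obtain ⟨f, hf, hle⟩ := Submodule.exists_le_ker_of_notMem h
    have hdot : ∀ x, f x = x ⬝ᵥ fun v => f (Pi.single v 1) := by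
      intro x
      conv_lhs => rw [pi_eq_sum_univ' x, map_sum]
      simp [dotProduct]
    refine Or.inr ⟨fun v => f (Pi.single v 1), ?_, by rwa [← hdot]⟩
    ext v
    have : f (C *ᵥ Pi.single v 1) = 0 := hle ⟨_, rfl⟩
    rw [hdot, hC.mulVec_dotProduct] at this
    simpa using this

end Nullity

/-! ### Bordered matrices and the three possible changes of nullity. -/

section Border

variable {W : Type*}

/-- The symmetric matrix with corner entry `a`, border `b` and remaining block `C`. -/
def border (a : ℝ) (b : W → ℝ) (C : Matrix W W ℝ) : Matrix (Option W) (Option W) ℝ :=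
  fun p q => p.elim (q.elim a b) fun v => q.elim (b v) (C v)

variable (a : ℝ) (b : W → ℝ) (C : Matrix W W ℝ)

@[simp] theorem border_none_none : border a b C none none = a := rfl
@[simp] theorem border_none_some (v : W) : border a b C none (some v) = b v := rfl
@[simp] theorem border_some_none (v : W) : border a b C (some v) none = b v := rfl
@[simp] theorem border_some_some (v w : W) : border a b C (some v) (some w) = C v w := rfl

theorem eq_border {A : Matrix (Option W) (Option W) ℝ} (hA : A.IsSymm) :
    A = border (A none none) (fun v => A none (some v)) (A.submatrix some some) := by
  ext p q
  cases p <;> cases q <;> simp [hA.apply]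

variable {a b C}

theorem border_isSymm : (border a b C).IsSymm ↔ C.IsSymm := by
  refine ⟨fun h => IsSymm.ext fun v w => h.apply (some v) (some w), fun h => IsSymm.ext ?_⟩
  intro p q
  cases p <;> cases q <;> simp [h.apply]

theorem border_mulVec_eq_zero_iff [Fintype W] (x : Option W → ℝ) :
    border a b C *ᵥ x = 0 ↔ a * x none + b ⬝ᵥ (x ∘ some) = 0 ∧
      x none • b + C *ᵥ (x ∘ some) = 0 := by
  rw [funext_iff, Option.forall, funext_iff]
  simp [mulVec, dotProduct, Fintype.sum_option, mul_comm]

/-- Extension of a vector by a zero coordinate. -/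
def extendZero : (W → ℝ) →ₗ[ℝ] (Option W → ℝ) where
  toFun x p := p.elim 0 x
  map_add' x y := by ext p; cases p <;> simp
  map_smul' c x := by ext p; cases p <;> simp

@[simp] theorem extendZero_none (x : W → ℝ) : extendZero x none = 0 := rfl
@[simp] theorem extendZero_some (x : W → ℝ) (v : W) : extendZero x (some v) = x v := rfl
@[simp] theorem extendZero_comp_some (x : W → ℝ) : extendZero x ∘ some = x := rfl

theorem border_mulVec_extendZero [Fintype W] (x : W → ℝ) :
    border a b C *ᵥ extendZero x = 0 ↔ b ⬝ᵥ x = 0 ∧ C *ᵥ x = 0 := by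
  simp [border_mulVec_eq_zero_iff]

/-- Restriction of a vector to the coordinates other than `none`. -/
def restrictSome : (Option W → ℝ) →ₗ[ℝ] (W → ℝ) := LinearMap.funLeft ℝ ℝ some

@[simp] theorem restrictSome_apply (x : Option W → ℝ) : restrictSome x = x ∘ some := rfl

theorem eq_zero_of_comp_some {x : Option W → ℝ} (h : x none = 0) (h' : x ∘ some = 0) : x = 0 := by
  ext p
  cases p with
  | none => exact h
  | some v => exact congrFun h' v

variable [Fintype W]

theorem eq_zero_of_smul_add_mulVec_eq_zero (hC : C.IsSymm) {w : W → ℝ} (hw : C *ᵥ w = 0)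
    (hbw : b ⬝ᵥ w ≠ 0) {t : ℝ} {x : W → ℝ} (h : t • b + C *ᵥ x = 0) : t = 0 := by
  have := congrArg (· ⬝ᵥ w) h
  simp only [add_dotProduct, smul_dotProduct, hC.mulVec_dotProduct, hw, dotProduct_zero, add_zero,
    zero_dotProduct, smul_eq_mul] at this
  exact (mul_eq_zero.mp this).resolve_right hbw

/-- Pairing with `w` forces the border coordinate of a kernel vector to vanish, so the kernel
becomes that of `C` cut by the hyperplane orthogonal to `b`. -/
theorem nullity_border_add_one (hC : C.IsSymm) {w : W → ℝ} (hw : C *ᵥ w = 0) (hbw : b ⬝ᵥ w ≠ 0) :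
    nullity (border a b C) + 1 = nullity C := by
  have key : ∀ x, border a b C *ᵥ x = 0 → x none = 0 := fun x hx =>
    eq_zero_of_smul_add_mulVec_eq_zero hC hw hbw ((border_mulVec_eq_zero_iff x).1 hx).2
  rw [← finrank_ker_inf_ker_add_one C (dotProductBilin ℝ ℝ b) hw (by simpa using hbw)]
  congr 1
  refine le_antisymm (finrank_le_of_mapsTo restrictSome _ _ ?_ ?_)
    (finrank_le_of_mapsTo extendZero _ _ ?_ ?_)
  · intro x hx
    have hx : border a b C *ᵥ x = 0 := by simpa using hx
    have h := (border_mulVec_eq_zero_iff x).1 hx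
    rw [key x hx] at h
    exact ⟨by simpa using h.2, by simpa using h.1⟩
  · intro x hx h
    exact eq_zero_of_comp_some (key x (by simpa using hx)) h
  · intro x hx
    have := (border_mulVec_extendZero (a := a) (b := b) (C := C) x).2
      ⟨by simpa using hx.2, by simpa using hx.1⟩
    simpa using this
  · intro x _ h
    simpa using congrArg (· ∘ some) h

/-- Block elimination with Schur complement `a - b ⬝ᵥ y`. Pairing the second equation with `y`
expresses `b ⬝ᵥ (x ∘ some)` through `x none`. -/
theorem border_mulVec_eq_zero_iff_of_eq (hC : C.IsSymm) {y : W → ℝ} (hy : C *ᵥ y = b)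
    (x : Option W → ℝ) : border a b C *ᵥ x = 0 ↔
      (a - b ⬝ᵥ y) * x none = 0 ∧ C *ᵥ (x none • y + x ∘ some) = 0 := by
  rw [border_mulVec_eq_zero_iff, mulVec_add, mulVec_smul, hy, and_congr_left_iff]
  intro h
  have := congrArg (y ⬝ᵥ ·) h
  simp only [dotProduct_add, dotProduct_smul, ← hC.mulVec_dotProduct, hy, dotProduct_zero,
    smul_eq_mul, dotProduct_comm y b] at this
  rw [sub_mul, sub_eq_add_neg, ← eq_neg_of_add_eq_zero_right this |>.trans (by ring : _ = -(b ⬝ᵥ y * x none))]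

theorem nullity_border_of_ne (hC : C.IsSymm) {y : W → ℝ} (hy : C *ᵥ y = b) (ha : a ≠ b ⬝ᵥ y) :
    nullity (border a b C) = nullity C := by
  have key : ∀ x, border a b C *ᵥ x = 0 → x none = 0 ∧ C *ᵥ (x ∘ some) = 0 := by
    intro x hx
    obtain ⟨h1, h2⟩ := (border_mulVec_eq_zero_iff_of_eq hC hy x).1 hx
    have h := (mul_eq_zero.mp h1).resolve_left (sub_ne_zero.2 ha)
    exact ⟨h, by simpa [h] using h2⟩
  refine le_antisymm (nullity_le_of_mapsTo _ _ restrictSome (fun x hx => (key x hx).2)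
    fun x hx h => eq_zero_of_comp_some (key x hx).1 h) (nullity_le_of_mapsTo _ _ extendZero ?_ ?_)
  · intro x hx
    rw [border_mulVec_eq_zero_iff_of_eq hC hy]
    simpa using hx
  · intro x _ h
    simpa using congrArg (· ∘ some) h

theorem nullity_border_of_eq (hC : C.IsSymm) {y : W → ℝ} (hy : C *ᵥ y = b) (ha : a = b ⬝ᵥ y) :
    nullity (border a b C) = nullity C + 1 := by
  have key := border_mulVec_eq_zero_iff_of_eq (a := a) hC hy
  simp only [ha, sub_self, zero_mul, true_and] at key
  rw [ha, ← finrank_ker_inf_ker_add_one (border (b ⬝ᵥ y) b C) (LinearMap.proj none)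
    (x := fun p => p.elim 1 (-y)) ((key _).2 ?_) (by simp)]
  · congr 1
    refine le_antisymm (finrank_le_of_mapsTo restrictSome _ _ ?_ ?_)
      (finrank_le_of_mapsTo extendZero _ _ ?_ ?_)
    · rintro x ⟨hx, h0⟩
      have hx := (key x).1 (by simpa using hx)
      have h0 : x none = 0 := h0
      simpa [h0] using hx
    · rintro x ⟨_, h0⟩ h
      exact eq_zero_of_comp_some h0 h
    · intro x hx
      exact ⟨by simpa using (key (extendZero x)).2 (by simpa using hx), by simp⟩
    · intro x _ h
      simpa using congrArg (· ∘ some) h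
  · have : ((fun p => p.elim 1 (-y) : Option W → ℝ) ∘ some) = -y := rfl
    simp [this]

theorem nullity_le_nullity_border_add_one (hC : C.IsSymm) :
    nullity C ≤ nullity (border a b C) + 1 := by
  obtain ⟨y, hy⟩ | ⟨w, hw, hbw⟩ := exists_mulVec_eq_or C hC b
  · by_cases ha : a = b ⬝ᵥ y
    · rw [nullity_border_of_eq hC hy ha]; omega
    · rw [nullity_border_of_ne hC hy ha]; omega
  · rw [nullity_border_add_one hC hw hbw]

end Border

/-! ### Strong Arnold property and SNIP in block form. -/

section StrongProperties

variable {V W : Type*}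

/-- `X` is symmetric, with zero diagonal, and vanishes on the edges of `G`. -/
def IsComplementary (G : SimpleGraph V) (X : Matrix V V ℝ) : Prop :=
  X.IsSymm ∧ (∀ v, X v v = 0) ∧ ∀ v w, G.Adj v w → X v w = 0

/-- The strong Arnold property of `A` relative to the graph `G`. -/
def HasSAP [Fintype V] (G : SimpleGraph V) (A : Matrix V V ℝ) : Prop :=
  ∀ X, IsComplementary G X → A * X = 0 → X = 0

/-- The strong nullity interlacing property at the index `none`, for a bordered matrix with border
`b` and block `C`, where `N` is the set of neighbors of `none`. -/
def HasBorderSNIP [Fintype W] (H : SimpleGraph W) (N : Set W) (b : W → ℝ) (C : Matrix W W ℝ) :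
    Prop :=
  ∀ (z : W → ℝ) (Y : Matrix W W ℝ), IsComplementary H Y → (∀ v ∈ N, z v = 0) → C *ᵥ z = 0 →
    vecMulVec b z + C * Y = 0 → z = 0 ∧ Y = 0

open Classical in
theorem isComplementary_iff {G : SimpleGraph V} {A : Matrix V V ℝ} (hA : IsGraphMatrix G A)
    {X : Matrix V V ℝ} : IsComplementary G X ↔
      X.IsSymm ∧ hadamard A X = 0 ∧ hadamard (1 : Matrix V V ℝ) X = 0 := by
  refine and_congr_right fun hX => ⟨fun ⟨h1, h2⟩ => ⟨?_, ?_⟩, fun ⟨h1, h2⟩ => ⟨?_, ?_⟩⟩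
  · ext v w
    by_cases hvw : v = w
    · simp [hvw, h1]
    · by_cases h : G.Adj v w
      · simp [h2 v w h]
      · have : A v w = 0 := by by_contra hne; exact h ((hA.2 v w hvw).1 hne)
        simp [this]
  · ext v w
    by_cases hvw : v = w
    · simp [hvw, h1]
    · simp [one_apply, hvw]
  · intro v
    simpa using congrFun (congrFun h2 v) v
  · intro v w h
    have := congrFun (congrFun h1 v) w
    simpa [(hA.2 v w h.ne).2 h] using this

theorem hasSNIP_iff [Fintype V] {G : SimpleGraph V} {A : Matrix V V ℝ} (hA : IsGraphMatrix G A)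
    (r : V) : HasSNIP A r ↔
      ∀ X, IsComplementary G X → (∀ v w, v ≠ r → (A * X) v w = 0) → X = 0 := by
  refine forall_congr' fun X => ?_
  rw [isComplementary_iff hA]
  have : (A * X).submatrix (Subtype.val : {v // v ≠ r} → V) id = 0 ↔
      ∀ v w, v ≠ r → (A * X) v w = 0 := by
    refine ⟨fun h v w hv => congrFun (congrFun h ⟨v, hv⟩) w, fun h => ?_⟩
    ext v w
    exact h v w v.2
  rw [this]
  tauto

end StrongProperties

/-! ### Passing between a rooted graph and its bordered form. -/

section Transport

variable {V W : Type*}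

/-- `e` identifies the vertices of `G` other than `r` with those of `H`, and the neighbors of `r`
with `N`. -/
structure RootSplit (G : SimpleGraph V) (r : V) (H : SimpleGraph W) (N : Set W)
    (e : V ≃ Option W) : Prop where
  map_root : e r = none
  adj_iff : ∀ a b, H.Adj a b ↔ G.Adj (e.symm (some a)) (e.symm (some b))
  mem_iff : ∀ a, a ∈ N ↔ G.Adj r (e.symm (some a))

variable {G : SimpleGraph V} {r : V} {H : SimpleGraph W} {N : Set W} {e : V ≃ Option W}
  {a : ℝ} {b : W → ℝ} {C : Matrix W W ℝ}

theorem RootSplit.symm_none (h : RootSplit G r H N e) : e.symm none = r := by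
  rw [← h.map_root, e.symm_apply_apply]

theorem RootSplit.isGraphMatrix_border_iff (h : RootSplit G r H N e) :
    IsGraphMatrix G ((border a b C).submatrix e e) ↔
      IsGraphMatrix H C ∧ ∀ v, b v ≠ 0 ↔ v ∈ N := by
  have hs : ((border a b C).submatrix e e).IsSymm ↔ C.IsSymm := by
    rw [← border_isSymm (a := a) (b := b)]
    refine ⟨fun h => ?_, fun h => h.submatrix e⟩
    simpa using h.submatrix e.symm
  rw [IsGraphMatrix, IsGraphMatrix, hs, and_assoc, and_congr_right_iff]
  intro hC
  rw [← e.symm.forall_congr_right]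
  simp_rw [← e.symm.forall_congr_right (q := fun x => _ ≠ x → _)]
  simp only [Option.forall, submatrix_apply, Equiv.apply_symm_apply, ne_eq,
    EmbeddingLike.apply_eq_iff_eq, Option.some_inj, not_true_eq_false, false_implies, true_and,
    reduceCtorEq, not_false_eq_true, true_implies, border_none_some, border_some_none,
    border_some_some, h.symm_none, ← h.adj_iff, ← h.mem_iff, G.adj_comm _ r]
  constructor
  · rintro ⟨h1, h2⟩
    exact ⟨fun a b => (h2 a).2 b, h1⟩
  · rintro ⟨h1, h2⟩
    exact ⟨h2, fun a => ⟨h2 a, h1 a⟩⟩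

theorem RootSplit.isComplementary_border_iff (h : RootSplit G r H N e) :
    IsComplementary G ((border 0 b C).submatrix e e) ↔
      IsComplementary H C ∧ ∀ v ∈ N, b v = 0 := by
  have hs : ((border 0 b C).submatrix e e).IsSymm ↔ C.IsSymm := by
    rw [← border_isSymm (a := 0) (b := b)]
    refine ⟨fun h => ?_, fun h => h.submatrix e⟩
    simpa using h.submatrix e.symm
  rw [IsComplementary, IsComplementary, hs, and_assoc, and_congr_right_iff]
  intro hC
  rw [← e.symm.forall_congr_right, ← e.symm.forall_congr_right]
  simp_rw [← e.symm.forall_congr_right (q := fun x => G.Adj _ x → _)]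
  simp only [Option.forall, submatrix_apply, Equiv.apply_symm_apply, true_and, border_none_none,
    implies_true,
    border_none_some, border_some_none,
    border_some_some, h.symm_none, ← h.adj_iff, ← h.mem_iff, G.adj_comm _ r]
  constructor
  · rintro ⟨h0, h1, h2⟩
    exact ⟨⟨h0, fun a b => (h2 a).2 b⟩, h1⟩
  · rintro ⟨⟨h0, h1⟩, h2⟩
    exact ⟨h0, h2, fun a => ⟨h2 a, h1 a⟩⟩

theorem exists_eq_border_submatrix (e : V ≃ Option W) {A : Matrix V V ℝ} (hA : A.IsSymm) :
    ∃ a b C, A = (border a b C).submatrix e e := by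
  have h := congrArg (fun M => M.submatrix e e) (eq_border (hA.submatrix e.symm))
  simp only [submatrix_submatrix, Equiv.symm_comp_self, submatrix_id_id] at h
  exact ⟨_, _, _, h⟩

variable [Fintype W]

theorem border_mul_border_apply (z : W → ℝ) (Y : Matrix W W ℝ) :
    (∀ v q, (border a b C * border 0 z Y) (some v) q = 0) ↔
      C *ᵥ z = 0 ∧ vecMulVec b z + C * Y = 0 := by
  simp only [Option.forall, mul_apply, Fintype.sum_option, forall_and, funext_iff, ← Matrix.ext_iff]
  simp [mulVec, dotProduct, vecMulVec_apply, mul_apply]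

theorem RootSplit.hasSNIP_iff [Fintype V] (h : RootSplit G r H N e)
    (hA : IsGraphMatrix G ((border a b C).submatrix e e)) :
    HasSNIP ((border a b C).submatrix e e) r ↔ HasBorderSNIP H N b C := by
  rw [_root_.hasSNIP_iff hA]
  have key : ∀ z Y, (∀ v w, v ≠ r → ((border a b C).submatrix e e *
      (border 0 z Y).submatrix e e) v w = 0) ↔ C *ᵥ z = 0 ∧ vecMulVec b z + C * Y = 0 := by
    intro z Y
    rw [submatrix_mul_equiv, ← border_mul_border_apply (a := a), ← e.symm.forall_congr_right]
    simp_rw [← e.symm.forall_congr_right (q := fun x => _ ≠ _ → submatrix _ _ _ _ x = _)]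
    simp only [← h.symm_none, ne_eq, EmbeddingLike.apply_eq_iff_eq, submatrix_apply,
      Equiv.apply_symm_apply]
    simp only [Option.forall (p := fun x => ∀ q : Option W, ¬ x = none → _), not_true_eq_false,
      reduceCtorEq, not_false_eq_true, false_implies, true_implies, implies_true, true_and]
  constructor
  · intro hS z Y hY hz hCz hCY
    have h0 := hS ((border 0 z Y).submatrix e e) (h.isComplementary_border_iff.2 ⟨hY, hz⟩)
      ((key z Y).2 ⟨hCz, hCY⟩)
    have h1 : border 0 z Y = 0 := by
      have := congrArg (fun M => M.submatrix e.symm e.symm) h0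
      simpa using this
    exact ⟨funext fun v => congrFun (congrFun h1 none) (some v),
      Matrix.ext fun v w => congrFun (congrFun h1 (some v)) (some w)⟩
  · intro hS X hX hAX
    obtain ⟨a', z, Y, rfl⟩ := exists_eq_border_submatrix e hX.1
    obtain rfl : a' = 0 := by simpa [h.map_root] using hX.2.1 r
    obtain ⟨hY, hz⟩ := h.isComplementary_border_iff.1 hX
    obtain ⟨h1, h2⟩ := (key z Y).1 hAX
    obtain ⟨rfl, rfl⟩ := hS z Y hY hz h1 h2
    ext v w
    rw [submatrix_apply]
    cases e v <;> cases e w <;> rfl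

theorem RootSplit.nullity_deleteIndex (h : RootSplit G r H N e) [Fintype {v // v ≠ r}] :
    nullity (deleteIndex ((border a b C).submatrix e e) r) = nullity C := by
  have hsome : ∀ w : W, e.symm (some w) ≠ r := fun w hw => by
    have := congrArg e hw
    simp [h.map_root] at this
  let f : W → {v // v ≠ r} := fun w => ⟨e.symm (some w), hsome w⟩
  have hf : Function.Bijective f := by
    refine ⟨fun x y hxy => ?_, fun ⟨v, hv⟩ => ?_⟩
    · simpa [f] using hxy
    · cases hev : e v with
      | none => exact absurd (e.injective (hev.trans h.map_root.symm)) hv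
      | some w => exact ⟨w, Subtype.ext (by simp [f, ← hev])⟩
  rw [← nullity_submatrix _ (Equiv.ofBijective f hf)]
  congr 1
  ext v w
  simp [deleteIndex, f]

end Transport

/-- The bordered form of `RootedGraph.AllowsSNIP`. -/
def AllowsBorder {W : Type*} [Fintype W] (H : SimpleGraph W) (N : Set W) (k l : ℕ) : Prop :=
  ∃ a b C, IsGraphMatrix H C ∧ (∀ v, b v ≠ 0 ↔ v ∈ N) ∧ nullity (border a b C) = k ∧
    nullity C = l ∧ HasBorderSNIP H N b C

theorem RootedGraph.allowsSNIP_iff {R : RootedGraph.{u}} {W : Type*} [Fintype W]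
    {H : SimpleGraph W} {N : Set W} {e : R.V ≃ Option W} (h : RootSplit R.graph R.root H N e)
    (k l : ℕ) : R.AllowsSNIP k l ↔ AllowsBorder H N k l := by
  classical
  constructor
  · rintro ⟨A, hA, hk, hl, hS⟩
    obtain ⟨a, b, C, rfl⟩ := exists_eq_border_submatrix e hA.1
    have hA' := h.isGraphMatrix_border_iff.1 hA
    rw [nullity_submatrix] at hk
    rw [h.nullity_deleteIndex] at hl
    exact ⟨a, b, C, hA'.1, hA'.2, hk, hl, (h.hasSNIP_iff hA).1 hS⟩
  · rintro ⟨a, b, C, hC, hb, hk, hl, hS⟩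
    have hA := (h.isGraphMatrix_border_iff (a := a)).2 ⟨hC, hb⟩
    exact ⟨(border a b C).submatrix e e, hA, by rwa [nullity_submatrix],
      by rwa [h.nullity_deleteIndex], (h.hasSNIP_iff hA).2 hS⟩

/-! ### Allowed pairs in terms of the strong Arnold property. -/

section Characterizations

variable {V W : Type*} [Fintype V] [Fintype W] {G : SimpleGraph V} {H : SimpleGraph W} {N : Set W}

theorem HasBorderSNIP.hasSAP {b : W → ℝ} {C : Matrix W W ℝ} (h : HasBorderSNIP H N b C) :
    HasSAP H C := fun Y hY hCY => (h 0 Y hY (by simp) (by simp) (by simpa using hCY)).2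

/-- Multiplying `b zᵀ + C Y = 0` on the left by `wᵀ` leaves `(b ⬝ᵥ w) z = 0`, so `z = 0` and SAP
takes care of `Y`. -/
theorem HasSAP.hasBorderSNIP {b : W → ℝ} {C : Matrix W W ℝ} (h : HasSAP H C) (hC : C.IsSymm)
    {w : W → ℝ} (hw : C *ᵥ w = 0) (hbw : b ⬝ᵥ w ≠ 0) : HasBorderSNIP H N b C := by
  intro z Y hY _ _ hCY
  have h0 : (b ⬝ᵥ w) • z = 0 := by
    have := congrArg (w ᵥ* ·) hCY
    simpa [vecMul_add, ← vecMul_vecMul, vecMul_vecMulVec, ← mulVec_transpose C, hC.eq, hw,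
      dotProduct_comm w b] using this
  have hz : z = 0 := (smul_eq_zero.1 h0).resolve_left hbw
  exact ⟨hz, h Y hY (by simpa [hz] using hCY)⟩

open Classical in
theorem exists_support_dotProduct_ne_zero (N : Set W) (w : W → ℝ) {j : W} (hj : j ∈ N)
    (hw : w j ≠ 0) : ∃ b : W → ℝ, (∀ v, b v ≠ 0 ↔ v ∈ N) ∧ b ⬝ᵥ w ≠ 0 := by
  set b : W → ℝ := fun v => if v ∈ N then 1 else 0 with hb
  by_cases h : b ⬝ᵥ w = 0
  -- If the indicator of `N` is orthogonal to `w`, raising its `j`-th entry to `2` keeps the support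
  -- and makes the product `w j`.
  · refine ⟨b + Pi.single j 1, fun v => ?_, by simp [add_dotProduct, h, hw]⟩
    by_cases hv : v = j
    · subst hv
      simp [hb, hj]
    · simp [hb, hv]
  · exact ⟨b, fun v => by simp [hb], h⟩

/-- The nullity drops exactly when `b` is outside the range of `C`, that is, not orthogonal to the
kernel. A border with support `N` and this property exists iff some kernel vector is nonzero on `N`.
-/
theorem allowsBorder_succ_iff {k : ℕ} : AllowsBorder H N k (k + 1) ↔
    ∃ C, IsGraphMatrix H C ∧ HasSAP H C ∧ nullity C = k + 1 ∧
      ∃ w, C *ᵥ w = 0 ∧ ∃ j ∈ N, w j ≠ 0 := by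
  constructor
  · rintro ⟨a, b, C, hC, hb, hk, hl, hS⟩
    refine ⟨C, hC, hS.hasSAP, hl, ?_⟩
    obtain ⟨y, hy⟩ | ⟨w, hw, hbw⟩ := exists_mulVec_eq_or C hC.1 b
    · by_cases ha : a = b ⬝ᵥ y
      · have := nullity_border_of_eq hC.1 hy ha
        omega
      · have := nullity_border_of_ne hC.1 hy ha
        omega
    · obtain ⟨j, -, hj⟩ := Finset.exists_ne_zero_of_sum_ne_zero hbw
      exact ⟨w, hw, j, (hb j).1 (left_ne_zero_of_mul hj), right_ne_zero_of_mul hj⟩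
  · rintro ⟨C, hC, hS, hl, w, hw, j, hj, hwj⟩
    obtain ⟨b, hb, hbw⟩ := exists_support_dotProduct_ne_zero N w hj hwj
    have := nullity_border_add_one (a := 0) hC.1 hw hbw
    exact ⟨0, b, C, hC, hb, by omega, hl, hS.hasBorderSNIP hC.1 hw hbw⟩

/-- Since `xᵀ A X = 0` and only row `r` of `A X` can be nonzero, `x r ≠ 0` makes that row vanish
too. -/
theorem HasSAP.hasSNIP {A : Matrix V V ℝ} (h : HasSAP G A) (hA : IsGraphMatrix G A)
    {x : V → ℝ} (hx : A *ᵥ x = 0) {r : V} (hr : x r ≠ 0) : HasSNIP A r := by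
  rw [hasSNIP_iff hA]
  intro X hX hAX
  refine h X hX ?_
  ext v w
  by_cases hv : v = r
  · subst hv
    have h0 : (x ᵥ* (A * X)) w = 0 := by
      rw [← vecMul_vecMul, ← mulVec_transpose A, hA.1.eq, hx, zero_vecMul]
      rfl
    rw [vecMul, dotProduct, Finset.sum_eq_single v] at h0
    · exact (mul_eq_zero.1 h0).resolve_left hr
    · intro u _ hu
      rw [hAX u w hu, mul_zero]
    · simp
  · exact hAX v w hv

/-- Equal nullities force `b = C y`. Only the corner entry then changes: the value `b ⬝ᵥ y` kills
the Schur complement and yields the kernel vector `(1, -y)`, while any other value restores the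
nullity of `C`. SNIP is insensitive to the corner. -/
theorem RootSplit.allowsBorder_self_iff {r : V} {e : V ≃ Option W} (h : RootSplit G r H N e)
    {k : ℕ} : AllowsBorder H N k k ↔ ∃ A, IsGraphMatrix G A ∧ HasSAP G A ∧ nullity A = k + 1 ∧
      ∃ x, A *ᵥ x = 0 ∧ x r ≠ 0 := by
  constructor
  · rintro ⟨a, b, C, hC, hb, hk, hl, hS⟩
    obtain ⟨y, hy⟩ | ⟨w, hw, hbw⟩ := exists_mulVec_eq_or C hC.1 b
    · have hA := (h.isGraphMatrix_border_iff (a := b ⬝ᵥ y)).2 ⟨hC, hb⟩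
      refine ⟨_, hA, ?_, ?_, (fun p => p.elim 1 (-y)) ∘ e, ?_, ?_⟩
      · intro X hX hAX
        exact (_root_.hasSNIP_iff hA r).1 ((h.hasSNIP_iff hA).2 hS) X hX (by simp [hAX])
      · rw [nullity_submatrix, nullity_border_of_eq hC.1 hy rfl, hl]
      · rw [submatrix_mulVec_equiv]
        have : ((fun p => p.elim 1 (-y) : Option W → ℝ) ∘ some) = -y := rfl
        rw [Function.comp_assoc, Equiv.self_comp_symm, Function.comp_id,
          (border_mulVec_eq_zero_iff_of_eq hC.1 hy _).2 (by simp [this])]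
        rfl
      · simp [h.map_root]
    · have := nullity_border_add_one (a := a) hC.1 hw hbw
      omega
  · rintro ⟨A, hA, hS, hk, x, hx, hxr⟩
    have hS' := hS.hasSNIP hA hx hxr
    obtain ⟨a, b, C, rfl⟩ := exists_eq_border_submatrix e hA.1
    rw [h.hasSNIP_iff hA] at hS'
    obtain ⟨hC, hb⟩ := h.isGraphMatrix_border_iff.1 hA
    rw [submatrix_mulVec_equiv] at hx
    have hx' : border a b C *ᵥ (x ∘ e.symm) = 0 := by
      have := congrArg (· ∘ e.symm) hx
      simpa [Function.comp_assoc] using this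
    rw [border_mulVec_eq_zero_iff] at hx'
    simp only [Function.comp_apply, h.symm_none] at hx'
    obtain ⟨h1, h2⟩ := hx'
    set y : W → ℝ := -(x r)⁻¹ • ((x ∘ e.symm) ∘ some) with hy
    have hCy : C *ᵥ y = b := by
      rw [hy, mulVec_smul, eq_neg_of_add_eq_zero_right h2]
      simp [smul_smul, hxr]
    have ha : a = b ⬝ᵥ y := by
      rw [hy, dotProduct_smul, smul_eq_mul, eq_neg_of_add_eq_zero_right h1]
      field_simp
    rw [nullity_submatrix, nullity_border_of_eq hC.1 hCy ha] at hk
    have hne : a + 1 ≠ b ⬝ᵥ y := by rw [← ha]; simp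
    exact ⟨a + 1, b, C, hC, hb, by rw [nullity_border_of_ne hC.1 hCy hne]; omega, by omega, hS'⟩

end Characterizations

/-! ### Symmetric perturbations supported on the diagonal and the edges. -/

section PatternPart

variable {W : Type*}

open scoped Classical in
/-- Symmetrization followed by restriction to the diagonal and the edges of `H`. -/
noncomputable def patternPart (H : SimpleGraph W) : Matrix W W ℝ →ₗ[ℝ] Matrix W W ℝ where
  toFun E := of fun v w => if v = w ∨ H.Adj v w then E v w + E w v else 0
  map_add' E F := by
    ext v w
    rw [Matrix.add_apply]
    simp only [of_apply, Matrix.add_apply]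
    split_ifs <;> ring
  map_smul' c E := by
    ext v w
    rw [Matrix.smul_apply]
    simp only [of_apply, Matrix.smul_apply, smul_eq_mul, RingHom.id_apply]
    split_ifs <;> ring

variable {H : SimpleGraph W}

theorem patternPart_apply_of_not {E : Matrix W W ℝ} {v w : W} (hne : v ≠ w) (h : ¬ H.Adj v w) :
    patternPart H E v w = 0 := by
  simp [patternPart, hne, h]

theorem patternPart_isSymm (E : Matrix W W ℝ) : (patternPart H E).IsSymm := by
  refine IsSymm.ext fun v w => ?_
  have := H.adj_comm v w
  simp only [patternPart, LinearMap.coe_mk, AddHom.coe_mk, of_apply]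
  split_ifs <;> grind

theorem patternPart_single [DecidableEq W] {v w : W} (h : v = w ∨ H.Adj v w) :
    patternPart H (single v w 1) = single v w 1 + single w v 1 := by
  ext p q
  simp only [patternPart, LinearMap.coe_mk, AddHom.coe_mk, of_apply, Matrix.add_apply, single_apply]
  have := H.adj_comm v w
  split_ifs <;> grind

end PatternPart

/-! ### Linear algebra of nullity-preserving perturbations. -/

section Perturbation

variable {W : Type*} [Fintype W] [DecidableEq W]

theorem exists_kernelProjection (C : Matrix W W ℝ) : ∃ P : Matrix W W ℝ, P.IsSymm ∧ P * P = P ∧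
    C * P = 0 ∧ ∀ x, C *ᵥ x = 0 → P *ᵥ x = x := by
  let T := toEuclideanCLM (n := W) (𝕜 := ℝ)
  let U := LinearMap.ker (T C).toLinearMap
  have hT : ∀ f, T (T.symm f) = f := T.apply_symm_apply
  have hinj : ∀ A B, T A = T B → A = B := fun A B h => EquivLike.injective T h
  refine ⟨T.symm U.starProjection, ?_, hinj _ _ ?_, hinj _ _ ?_, ?_⟩
  · have h : star (T.symm U.starProjection) = T.symm U.starProjection := by
      refine hinj _ _ ?_
      rw [map_star, hT, (isSelfAdjoint_starProjection U).star_eq]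
    rwa [star_eq_conjTranspose, conjTranspose_eq_transpose_of_trivial] at h
  · rw [map_mul, hT, U.isIdempotentElem_starProjection.eq]
  · rw [map_mul, map_zero, hT]
    ext1 x
    exact (U.starProjection_apply_mem x : _)
  · intro x hx
    have hU : WithLp.toLp 2 x ∈ U := by
      change T C (WithLp.toLp 2 x) = 0
      rw [toEuclideanCLM_toLp, hx]
      rfl
    have h := Submodule.starProjection_eq_self_iff.2 hU
    rw [← hT U.starProjection, toEuclideanCLM_toLp] at h
    simpa using h

variable {C P : Matrix W W ℝ}

theorem isUnit_add_kernelProjection (hP : P * P = P) (hPC : P * C = 0)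
    (hker : ∀ x, C *ᵥ x = 0 → P *ᵥ x = x) : IsUnit (C + P) := by
  rw [← mulVec_injective_iff_isUnit, ← coe_mulVecLin, ← LinearMap.ker_eq_bot,
    LinearMap.ker_eq_bot']
  intro x hx
  have hx : C *ᵥ x + P *ᵥ x = 0 := by simpa [add_mulVec] using hx
  have h1 : P *ᵥ x = 0 := by
    have := congrArg (P *ᵥ ·) hx
    simpa [mulVec_add, mulVec_mulVec, hPC, hP] using this
  rw [h1, add_zero] at hx
  rw [← hker x hx, h1]

/-- If `P M⁻¹ P = P` for the kernel projection `P` of `C`, then `M - P` has the nullity of `C`. -/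
theorem nullity_sub_kernelProjection (hCP : C * P = 0)
    (hker : ∀ x, C *ᵥ x = 0 → P *ᵥ x = x) {M N : Matrix W W ℝ} (hMN : M * N = 1)
    (h : P * N * P = P) : nullity (M - P) = nullity C := by
  have hNM : N * M = 1 := mul_eq_one_comm.1 hMN
  refine le_antisymm (nullity_le_of_mapsTo _ _ M.mulVecLin ?_ ?_)
    (nullity_le_of_mapsTo _ _ N.mulVecLin ?_ ?_)
  · intro x hx
    have hx : M *ᵥ x = P *ᵥ x := sub_eq_zero.1 (by rwa [← sub_mulVec])
    rw [mulVecLin_apply, hx, mulVec_mulVec, hCP, zero_mulVec]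
  · intro x _ hx
    have := congrArg (N *ᵥ ·) hx
    simpa [mulVec_mulVec, hNM] using this
  · intro x hx
    rw [mulVecLin_apply, mulVec_mulVec, sub_mul, hMN, sub_mulVec, one_mulVec]
    nth_rw 2 [← hker x hx]
    rw [mulVec_mulVec, h, hker x hx, sub_self]
  · intro x _ hx
    have := congrArg (M *ᵥ ·) hx
    simpa [mulVec_mulVec, hMN] using this

variable {H : SimpleGraph W}

/-- The complementary matrices are the orthogonal complement, for the trace form, of the admissible
perturbations among symmetric matrices; elementary matrices test each entry. -/
theorem isComplementary_of_trace_patternPart {T : Matrix W W ℝ}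
    (hT : ∀ E, trace (T * patternPart H E) = 0) : IsComplementary H (T + Tᵀ) := by
  have key : ∀ v w, (v = w ∨ H.Adj v w) → (T + Tᵀ) v w = 0 := by
    intro v w h
    have := hT (single v w 1)
    rw [patternPart_single h, mul_add, trace_add, trace_mul_single, trace_mul_single] at this
    simpa [add_comm] using this
  exact ⟨isSymm_add_transpose_self T, fun v => key v v (Or.inl rfl), fun v w h => key v w (Or.inr h)⟩

/-- Compression of the symmetric part by `P`. -/
noncomputable def symmCompression (P : Matrix W W ℝ) : Matrix W W ℝ →ₗ[ℝ] Matrix W W ℝ where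
  toFun L := (1 / 2 : ℝ) • (P * (L + Lᵀ) * P)
  map_add' L M := by
    rw [← smul_add, transpose_add]
    congr 1
    noncomm_ring
  map_smul' c L := by
    simp [← smul_add, smul_comm c]

theorem trace_mul_symmCompression (hP : P.IsSymm) (S L : Matrix W W ℝ) :
    trace (S * symmCompression P L) = trace (symmCompression P S * L) := by
  have h : ∀ X Y : Matrix W W ℝ, trace (X * (P * Y * P)) = trace (P * X * P * Y) := by
    intro X Y
    rw [← Matrix.mul_assoc, trace_mul_comm]
    simp only [Matrix.mul_assoc]
  have h' : trace (P * S * P * Lᵀ) = trace (P * Sᵀ * P * L) := by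
    rw [← trace_transpose, trace_mul_comm _ L]
    simp only [transpose_mul, transpose_transpose, hP.eq, Matrix.mul_assoc]
  simp only [symmCompression, LinearMap.coe_mk, AddHom.coe_mk, mul_smul_comm, smul_mul_assoc,
    trace_smul, mul_add, add_mul, trace_add, h, h']

theorem symmCompression_compression (hPs : P.IsSymm) (hP : P * P = P)
    {S : Matrix W W ℝ} (hS : S.IsSymm) :
    symmCompression P (P * S * P) = P * S * P := by
  have h : (P * S * P)ᵀ = P * S * P := by
    simp only [transpose_mul, hPs.eq, hS.eq, Matrix.mul_assoc]
  simp only [symmCompression, LinearMap.coe_mk, AddHom.coe_mk, h, ← two_smul ℝ (P * S * P),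
    mul_smul_comm, smul_mul_assoc, smul_smul, ← Matrix.mul_assoc, hP]
  simp [Matrix.mul_assoc, hP]

theorem symmCompression_symmCompression (hPs : P.IsSymm) (hP : P * P = P) (L : Matrix W W ℝ) :
    symmCompression P (symmCompression P L) = symmCompression P L := by
  have h : symmCompression P L = P * ((1 / 2 : ℝ) • (L + Lᵀ)) * P := by
    rw [mul_smul_comm, smul_mul_assoc]
    rfl
  rw [h, symmCompression_compression hPs hP ((isSymm_add_transpose_self L).smul _)]

/-- The derivative used to perturb a matrix with the strong nullity interlacing property. -/
theorem surjective_of_hasBorderSNIP {N : Set W} {b : W → ℝ} (hS : HasBorderSNIP H N b C)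
    (hP : P.IsSymm) (hPP : P * P = P) (hCP : C * P = 0) {y u : W → ℝ}
    (hy : C *ᵥ y = b) (hu : C *ᵥ u = 0) (hu0 : u ≠ 0) (huN : ∀ v ∈ N, u v = 0)
    (D : Matrix W W ℝ × Matrix W W ℝ →ₗ[ℝ] Matrix W W ℝ × ℝ)
    (hD : ∀ E L, D (E, L) = (-(P * patternPart H E * P) + (L - symmCompression P L),
      -(y ⬝ᵥ (patternPart H E *ᵥ u)))) : LinearMap.range D = ⊤ := by
  by_contra hne
  -- A nonzero functional killing the range is represented by a pair `(S, s)` through the trace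
  -- form; SNIP will force both to vanish.
  obtain ⟨f, hf0, hf⟩ := Submodule.exists_le_ker_of_lt_top _ (lt_top_iff_ne_top.2 hne)
  set S : Matrix W W ℝ := of fun v w => f (single w v 1, 0) with hSdef
  set s : ℝ := f (0, 1) with hs
  have hfS : ∀ X t, f (X, t) = trace (S * X) + s * t := by
    intro X t
    have h1 : (X, t) = LinearMap.inl ℝ _ ℝ X + t • ((0 : Matrix W W ℝ), (1 : ℝ)) := by
      simp
    have h2 : f (LinearMap.inl ℝ _ ℝ X) = trace (S * X) := by
      have : f ∘ₗ LinearMap.inl ℝ _ ℝ = traceLinearMap W ℝ ℝ ∘ₗ LinearMap.mulLeft ℝ S := by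
        refine ext_linearMap _ fun v w => ?_
        ext
        simp [hSdef, trace_mul_single]
      exact LinearMap.congr_fun this X
    rw [h1, map_add, h2, map_smul, smul_eq_mul, mul_comm]
  have hfD : ∀ E L, f (D (E, L)) = 0 := fun E L => hf ⟨_, rfl⟩
  simp only [hD, hfS] at hfD
  -- Varying `L` alone shows that `S` is symmetric and lives on the kernel of `C`.
  have hSS : S = symmCompression P S := by
    rw [ext_iff_trace_mul_right]
    intro L
    have := hfD 0 L
    simp [mul_sub, trace_mul_symmCompression hP] at this
    linarith
  have hSS' : S = (1 / 2 : ℝ) • (P * (S + Sᵀ) * P) := hSS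
  have hST : S.IsSymm := by
    rw [hSS', IsSymm]
    simp only [transpose_smul, transpose_mul, transpose_add, transpose_transpose, hP.eq,
      Matrix.mul_assoc, add_comm]
  have hCS : C * S = 0 := by
    rw [hSS', mul_smul_comm, ← Matrix.mul_assoc, ← Matrix.mul_assoc, hCP]
    simp
  have hPSP : P * S * P = S := by
    rw [hSS', mul_smul_comm, smul_mul_assoc, ← Matrix.mul_assoc, ← Matrix.mul_assoc, hPP,
      Matrix.mul_assoc _ P P, hPP]
  -- Varying `E` alone makes `T = S + s u yᵀ` orthogonal to all admissible perturbations.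
  have hT : ∀ E, trace ((S + s • vecMulVec u y) * patternPart H E) = 0 := by
    intro E
    have h1 := hfD E 0
    have h2 : trace (S * (P * patternPart H E * P)) = trace (S * patternPart H E) := by
      rw [← Matrix.mul_assoc, trace_mul_comm, ← Matrix.mul_assoc, ← Matrix.mul_assoc, hPSP]
    have h3 : trace (vecMulVec u y * patternPart H E) = y ⬝ᵥ (patternPart H E *ᵥ u) := by
      rw [vecMulVec_mul, trace_vecMulVec, dotProduct_mulVec, dotProduct_comm]
    simp only [map_zero, sub_zero, add_zero, mul_neg, trace_neg, h2] at h1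
    rw [add_mul, trace_add, smul_mul_assoc, trace_smul, h3, smul_eq_mul]
    linarith
  have hY := isComplementary_of_trace_patternPart hT
  -- Since `C S = 0`, `C u = 0` and `C y = b`, one has `C (T + Tᵀ) = s b uᵀ`, which is cancelled by
  -- the choice `z = -s u`.
  obtain ⟨hz, hY0⟩ := hS (-s • u) _ hY (by simp +contextual [huN]) (by rw [mulVec_smul, hu, smul_zero]) (by
    rw [transpose_add, hST.eq, transpose_smul, transpose_vecMulVec]
    simp only [mul_add, hCS, mul_smul_comm, mul_vecMulVec, hu, hy, vecMulVec_smul, vecMulVec_neg, zero_add,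
      zero_vecMulVec, smul_zero, neg_smul, neg_add_cancel])
  have hs0 : s = 0 := by simpa [hu0] using hz
  have hS0 : S = 0 := by
    rw [transpose_add, hs0, zero_smul, transpose_zero, add_zero, add_zero, hST.eq, ← two_smul ℝ] at hY0
    simpa using hY0
  apply hf0
  ext1 <;> ext1 <;> simp [hfS, hS0, hs0]

end Perturbation

/-! ### Openness of the strong Arnold property and of the edge pattern. -/

section Openness

variable {W : Type*} [Fintype W]

open scoped Matrix.Norms.Operator Topology
open Filter

/-- SAP says that `X ↦ C X` is injective on a finite-dimensional space, hence bounded below there,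
and a perturbation smaller than the bound cannot destroy this. -/
theorem HasSAP.eventually {H : SimpleGraph W} {C : Matrix W W ℝ} (h : HasSAP H C) :
    ∀ᶠ E : Matrix W W ℝ in 𝓝 0, HasSAP H (C + E) := by
  classical
  let S : Submodule ℝ (Matrix W W ℝ) :=
    { carrier := {X | IsComplementary H X}
      zero_mem' := ⟨isSymm_zero, by simp, by simp⟩
      add_mem' := fun {X Y} hX hY => ⟨hX.1.add hY.1, by simp [hX.2.1, hY.2.1],
        fun v w hvw => by simp [hX.2.2 v w hvw, hY.2.2 v w hvw]⟩
      smul_mem' := fun c X hX => ⟨hX.1.smul c, by simp [hX.2.1],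
        fun v w hvw => by simp [hX.2.2 v w hvw]⟩ }
  obtain ⟨K, hK, hlip⟩ := LinearMap.exists_antilipschitzWith
    ((LinearMap.mulLeft ℝ C).domRestrict S) (by
      rw [LinearMap.ker_eq_bot']
      rintro ⟨X, hX⟩ hCX
      exact Subtype.ext (h X hX hCX))
  have hbound : ∀ X, IsComplementary H X → ‖X‖ ≤ K * ‖C * X‖ := fun X hX => by
    simpa using hlip.le_mul_norm_sub (⟨X, hX⟩ : S) 0
  have hK' : (0 : ℝ) < K := hK
  filter_upwards [Metric.ball_mem_nhds (0 : Matrix W W ℝ) (inv_pos.2 hK')] with E hE X hX hEX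
  rw [mem_ball_zero_iff] at hE
  have h1 : C * X = -(E * X) := by
    rw [add_mul] at hEX
    exact eq_neg_of_add_eq_zero_left hEX
  have h2 := hbound X hX
  rw [h1, norm_neg] at h2
  by_contra hne
  have hpos : 0 < ‖X‖ := norm_pos_iff.2 hne
  have h3 : ‖E * X‖ < (K : ℝ)⁻¹ * ‖X‖ :=
    (norm_mul_le E X).trans_lt (mul_lt_mul_of_pos_right hE hpos)
  have h4 := mul_lt_mul_of_pos_left h3 hK'
  rw [← mul_assoc, mul_inv_cancel₀ hK'.ne', one_mul] at h4
  linarith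

theorem IsGraphMatrix.eventually_add_patternPart {H : SimpleGraph W} {C : Matrix W W ℝ}
    (hC : IsGraphMatrix H C) :
    ∀ᶠ E : Matrix W W ℝ in 𝓝 0, IsGraphMatrix H (C + patternPart H E) := by
  classical
  have h : ∀ v w, ∀ᶠ E : Matrix W W ℝ in 𝓝 0, H.Adj v w → (C + patternPart H E) v w ≠ 0 := by
    intro v w
    by_cases hvw : H.Adj v w
    · have hc : Continuous fun E : Matrix W W ℝ => (C + patternPart H E) v w :=
        LinearMap.continuous_of_finiteDimensional (patternPart H) |>.const_add C
          |>.matrix_elem v w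
      have h0 : (C + patternPart H 0) v w ≠ 0 := by
        simpa using (hC.2 v w hvw.ne).2 hvw
      filter_upwards [hc.continuousAt.eventually_ne h0] with E hE _ using hE
    · exact Eventually.of_forall fun _ h => absurd h hvw
  filter_upwards [eventually_all.2 fun v => eventually_all.2 (h v)] with E hE
  refine ⟨hC.1.add (patternPart_isSymm E), fun v w hne => ⟨fun h => ?_, hE v w⟩⟩
  by_contra hvw
  refine h ?_
  rw [Matrix.add_apply, patternPart_apply_of_not hne hvw, add_zero]
  by_contra h0
  exact hvw ((hC.2 v w hne).1 h0)

end Openness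

/-! ### From the pair `(k + 1, k + 1)` to `(k, k + 1)`. -/

section StepDown

variable {W : Type*} [Fintype W] [DecidableEq W]

open scoped Matrix.Norms.Operator Topology
open Filter

/-- The evaluation of the compressed inverse and of the border along a kernel vector. -/
noncomputable def compressionMap (P : Matrix W W ℝ) (b u : W → ℝ) :
    Matrix W W ℝ × Matrix W W ℝ →L[ℝ] Matrix W W ℝ × ℝ :=
  LinearMap.toContinuousLinearMap
    { toFun := fun x => (P * x.1 * P + (x.2 - symmCompression P x.2), b ⬝ᵥ (x.1 *ᵥ u))
      map_add' := fun x y => by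
        ext1
        · simp only [Prod.fst_add, Prod.snd_add, mul_add, add_mul, map_add]
          abel
        · simp [add_mulVec]
      map_smul' := fun c x => by
        ext1
        · simp [smul_add, smul_sub]
        · simp [smul_mulVec] }

theorem compressionMap_apply (P : Matrix W W ℝ) (b u : W → ℝ) (x : Matrix W W ℝ × Matrix W W ℝ) :
    compressionMap P b u x =
      (P * x.1 * P + (x.2 - symmCompression P x.2), b ⬝ᵥ (x.1 *ᵥ u)) := rfl

/-- With `P` the projection onto the kernel of `C`, `M = C + P + patternPart H E` stays invertible
for small `E`. If `P M⁻¹ P = P`, then `M - P` keeps the nullity and has `M⁻¹ u` in its kernel. It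
remains to solve this equation together with `b ⬝ᵥ M⁻¹ u = t` for a small `t ≠ 0`, which a
surjective derivative at `E = 0` permits. -/
theorem exists_perturbation {H : SimpleGraph W} {N : Set W} {b : W → ℝ} {C : Matrix W W ℝ}
    (hC : IsGraphMatrix H C) (hS : HasBorderSNIP H N b C) {y u : W → ℝ} (hy : C *ᵥ y = b)
    (hu : C *ᵥ u = 0) (hu0 : u ≠ 0) (huN : ∀ v ∈ N, u v = 0) :
    ∃ C', IsGraphMatrix H C' ∧ HasSAP H C' ∧ nullity C' = nullity C ∧
      ∃ w, C' *ᵥ w = 0 ∧ b ⬝ᵥ w ≠ 0 := by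
  obtain ⟨P, hP, hPP, hCP, hker⟩ := exists_kernelProjection C
  have hPC : P * C = 0 := by
    simpa [transpose_mul, hP.eq, hC.1.eq] using congrArg transpose hCP
  obtain ⟨m, hm⟩ := isUnit_add_kernelProjection hPP hPC hker
  have hmP : (m : Matrix W W ℝ) * P = P := by rw [hm, add_mul, hCP, hPP, zero_add]
  have hPm : P * (m : Matrix W W ℝ) = P := by rw [hm, mul_add, hPC, hPP, zero_add]
  have hNP : (↑m⁻¹ : Matrix W W ℝ) * P = P := by
    rw [Units.inv_mul_eq_iff_eq_mul, hmP]
  have hPN : P * (↑m⁻¹ : Matrix W W ℝ) = P := by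
    rw [Units.mul_inv_eq_iff_eq_mul, hPm]
  have hNu : (↑m⁻¹ : Matrix W W ℝ) *ᵥ u = u := by
    nth_rw 1 [← hker u hu]
    rw [mulVec_mulVec, hNP, hker u hu]
  -- Removing the kernel component of `y` gives the solution of `C y = b` that equals `m⁻¹ b`, the
  -- vector occurring in the derivative.
  have hmy : (m : Matrix W W ℝ) *ᵥ (y - P *ᵥ y) = b := by
    rw [hm, mulVec_sub, add_mulVec, add_mulVec, mulVec_mulVec, mulVec_mulVec, hCP, hPP, hy]
    simp
  have hCy : C *ᵥ (y - P *ᵥ y) = b := by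
    rw [mulVec_sub, mulVec_mulVec, hCP, hy]
    simp
  have hmsymm : (m : Matrix W W ℝ).IsSymm := hm ▸ hC.1.add hP
  have hbu : b ⬝ᵥ u = 0 := by
    rw [← hy, hC.1.mulVec_dotProduct, hu, dotProduct_zero]
  let pat : Matrix W W ℝ →L[ℝ] Matrix W W ℝ := LinearMap.toContinuousLinearMap (patternPart H)
  have hpat : ∀ E, pat E = patternPart H E := fun _ => rfl
  -- The auxiliary variable `L` fills a complement of the symmetric matrices living on the kernel,
  -- so that the derivative can be onto the full matrix space.
  let Φ : Matrix W W ℝ × Matrix W W ℝ → Matrix W W ℝ × ℝ := fun x =>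
    compressionMap P b u (Ring.inverse (m + pat x.1), x.2)
  let D := (compressionMap P b u).comp
    (((-(ContinuousLinearMap.mulLeftRight ℝ (Matrix W W ℝ)) ↑m⁻¹ ↑m⁻¹).comp
      (pat.comp (ContinuousLinearMap.fst ℝ _ _))).prod (ContinuousLinearMap.snd ℝ _ _))
  have hinner : HasStrictFDerivAt (fun x : Matrix W W ℝ × Matrix W W ℝ => ↑m + pat x.1)
      (pat.comp (ContinuousLinearMap.fst ℝ _ _)) 0 :=
    ((pat.comp (ContinuousLinearMap.fst ℝ _ (Matrix W W ℝ))).hasStrictFDerivAt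
      (x := 0)).const_add (m : Matrix W W ℝ)
  have hΦ : HasStrictFDerivAt Φ D 0 := by
    refine (compressionMap P b u).hasStrictFDerivAt.comp _ (.prodMk ?_ hasStrictFDerivAt_snd)
    refine HasStrictFDerivAt.comp (g := Ring.inverse) _ ?_ hinner
    simpa using hasStrictFDerivAt_ringInverse m
  have hrange : (D : Matrix W W ℝ × Matrix W W ℝ →ₗ[ℝ] Matrix W W ℝ × ℝ).range = ⊤ := by
    refine surjective_of_hasBorderSNIP hS hP hPP hCP hCy hu hu0 huN _ fun E L => ?_
    have hD : D (E, L) = (P * -((↑m⁻¹ : Matrix W W ℝ) * patternPart H E * (↑m⁻¹ : Matrix W W ℝ)) * P +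
        (L - symmCompression P L),
        b ⬝ᵥ (-((↑m⁻¹ : Matrix W W ℝ) * patternPart H E * (↑m⁻¹ : Matrix W W ℝ)) *ᵥ u)) := rfl
    refine Eq.trans hD ?_
    refine Prod.ext ?_ ?_
    · simp only [mul_neg, neg_mul]
      rw [← Matrix.mul_assoc, ← Matrix.mul_assoc, hPN, Matrix.mul_assoc _ _ P, hNP]
    · rw [neg_mulVec, dotProduct_neg, ← mulVec_mulVec, hNu, ← mulVec_mulVec, ← hmy,
        hmsymm.mulVec_dotProduct, mulVec_mulVec _ _ (_ : Matrix W W ℝ), m.mul_inv, one_mulVec]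
  have hmap := hΦ.map_nhds_eq_of_surj hrange
  have hΦ0 : Φ 0 = (P, 0) := by
    simp only [Φ, compressionMap_apply, Prod.fst_zero, Prod.snd_zero, map_zero, add_zero,
      Ring.inverse_unit, hPN, hPP, hNu, hbu, sub_zero]
  have hgood : ∀ᶠ x : Matrix W W ℝ × Matrix W W ℝ in 𝓝 0,
      IsUnit ((m : Matrix W W ℝ) + pat x.1) ∧ IsGraphMatrix H (C + patternPart H x.1) ∧
        HasSAP H (C + patternPart H x.1) := by
    have h1 : Tendsto (fun x : Matrix W W ℝ × Matrix W W ℝ => x.1) (𝓝 0) (𝓝 0) :=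
      continuous_fst.tendsto' _ _ rfl
    have h2 : Tendsto (fun x : Matrix W W ℝ × Matrix W W ℝ => pat x.1) (𝓝 0) (𝓝 0) :=
      (pat.continuous.comp continuous_fst).tendsto' _ _ (by simp)
    have h3 : Tendsto (fun x : Matrix W W ℝ × Matrix W W ℝ => (m : Matrix W W ℝ) + pat x.1)
        (𝓝 0) (𝓝 m) := by
      simpa using h2.const_add (m : Matrix W W ℝ)
    exact (h3.eventually (Units.nhds m)).and ((h1.eventually hC.eventually_add_patternPart).and
      (h2.eventually hS.hasSAP.eventually))
  have himage := hmap.ge (Filter.image_mem_map (m := Φ) hgood)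
  rw [hΦ0] at himage
  -- The image of the good parameters is a neighborhood of `(P, 0)`, so it contains `(P, t)` for
  -- some `t ≠ 0`.
  have hpath : Tendsto (fun t : ℝ => (P, t)) (𝓝[≠] 0) (𝓝 (P, 0)) :=
    ((Continuous.prodMk_right P).tendsto 0).mono_left nhdsWithin_le_nhds
  obtain ⟨t, ⟨⟨E, L⟩, ⟨⟨M, hM⟩, hgraph, hsap⟩, hEL⟩, ht⟩ :=
    ((hpath.eventually himage).and self_mem_nhdsWithin).exists
  have hΦE : Φ (E, L) =
      (P * (↑M⁻¹ : Matrix W W ℝ) * P + (L - symmCompression P L), b ⬝ᵥ ((↑M⁻¹ : Matrix W W ℝ) *ᵥ u)) := by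
    simp only [Φ, compressionMap_apply]
    rw [← hM, Ring.inverse_unit]
  rw [hΦE, Prod.mk.injEq] at hEL
  have hMC : (M : Matrix W W ℝ) - P = C + patternPart H E := by
    rw [hM, hm, hpat]
    abel
  have hMsymm : (M : Matrix W W ℝ).IsSymm := by
    rw [hM, hpat]
    exact hmsymm.add (patternPart_isSymm E)
  have hMisymm : (↑M⁻¹ : Matrix W W ℝ).IsSymm := by
    rw [coe_units_inv, IsSymm, transpose_nonsing_inv, hMsymm.eq]
  -- Applying the idempotent `symmCompression P` removes the contribution of `L`.
  have hcomp : P * (↑M⁻¹ : Matrix W W ℝ) * P = P := by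
    have h1 := congrArg (symmCompression P) hEL.1
    have h2 : symmCompression P P = P := by
      simpa [hPP] using symmCompression_compression hP hPP hP
    rwa [map_add, map_sub, symmCompression_symmCompression hP hPP, sub_self, add_zero, h2,
      symmCompression_compression hP hPP hMisymm] at h1
  refine ⟨C + patternPart H E, hgraph, hsap, ?_, (↑M⁻¹ : Matrix W W ℝ) *ᵥ u, ?_, ?_⟩
  · rw [← hMC]
    exact nullity_sub_kernelProjection hCP hker M.mul_inv hcomp
  · rw [← hMC, mulVec_mulVec, sub_mul, M.mul_inv, sub_mulVec, one_mulVec]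
    nth_rw 2 [← hker u hu]
    rw [mulVec_mulVec, hcomp, hker u hu, sub_self]
  · rw [hEL.2]
    exact ht

theorem AllowsBorder.step_down {H : SimpleGraph W} {N : Set W} {k : ℕ}
    (h : AllowsBorder H N (k + 1) (k + 1)) : AllowsBorder H N k (k + 1) := by
  obtain ⟨a, b, C, hC, hb, hk, hl, hS⟩ := h
  rw [allowsBorder_succ_iff]
  by_cases hex : ∃ w, C *ᵥ w = 0 ∧ ∃ j ∈ N, w j ≠ 0
  · exact ⟨C, hC, hS.hasSAP, hl, hex⟩
  -- In the remaining case every kernel vector vanishes on `N`, the situation in which `C` has to be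
  -- perturbed.
  push Not at hex
  obtain ⟨y, hy⟩ | ⟨w, hw, hbw⟩ := exists_mulVec_eq_or C hC.1 b
  · obtain ⟨u, hu, hu0⟩ : ∃ u, C *ᵥ u = 0 ∧ u ≠ 0 := by
      by_contra! hcon
      have : LinearMap.ker C.mulVecLin = ⊥ := LinearMap.ker_eq_bot'.2 hcon
      rw [nullity, this, finrank_bot] at hl
      omega
    obtain ⟨C', hC', hS', hn, w, hw, hbw⟩ := exists_perturbation hC hS hy hu hu0 (hex u hu)
    obtain ⟨j, -, hj⟩ := Finset.exists_ne_zero_of_sum_ne_zero hbw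
    exact ⟨C', hC', hS', hn.trans hl, w, hw, j, (hb j).1 (left_ne_zero_of_mul hj),
      right_ne_zero_of_mul hj⟩
  · have := nullity_border_add_one (a := a) hC.1 hw hbw
    omega

end StepDown

/-! ### Invariance of minors under isomorphism. -/

namespace RootedGraph

section Isomorphisms

variable {R S T F : RootedGraph.{u}}

theorem IsIso.refl (R : RootedGraph.{u}) : R.IsIso R := ⟨.refl, rfl⟩

theorem IsIso.symm : R.IsIso S → S.IsIso R := fun ⟨e, he⟩ => ⟨e.symm, by simp [← he]⟩

theorem Step.isIso_right (h : Step R S) (hS : S.IsIso T) : Step R T := by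
  obtain ⟨φ, hφ⟩ := hS.symm
  cases h with
  | deleteEdge a b hab e he => exact .deleteEdge a b hab (φ.trans e) (by simp [hφ, he])
  | deleteVertex v hv e he => exact .deleteVertex v hv (φ.trans e) (by simp [hφ, he])
  | contractEdge a b hab f hf hfib hadj hroot =>
    refine .contractEdge a b hab (φ.symm ∘ f) (φ.symm.surjective.comp hf) ?_ ?_ ?_
    · simpa using hfib
    · intro x y
      rw [← φ.map_adj_iff, hadj]
      simp [φ.symm_apply_eq]
    · simp [hroot, ← hφ]

theorem Step.isIso_left (h : Step R F) (hR : R.IsIso S) : Step S F := by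
  obtain ⟨φ, hφ⟩ := hR
  cases h with
  | deleteEdge a b hab e he =>
    refine .deleteEdge (φ a) (φ b) (φ.map_adj_iff.2 hab) (e.trans ⟨φ.toEquiv, ?_⟩) ?_
    · intro x y
      simpa [SimpleGraph.deleteEdges_adj] using fun _ _ => φ.map_adj_iff
    · simp [he, hφ]
  | deleteVertex v hv e he =>
    refine .deleteVertex (φ v) (by simpa [← hφ] using hv)
      (e.trans ⟨φ.toEquiv.subtypeEquiv fun x => by simp, ?_⟩) ?_
    · intro x y
      simpa using φ.map_adj_iff
    · simp [he, hφ]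
  | contractEdge a b hab f hf hfib hadj hroot =>
    refine .contractEdge (φ a) (φ b) (φ.map_adj_iff.2 hab) (f ∘ φ.symm)
      (hf.comp φ.symm.surjective) ?_ ?_ ?_
    · intro x y
      simp [hfib, RelIso.symm_apply_eq]
    · intro x y
      rw [hadj, ← φ.symm.toEquiv.exists_congr_right]
      simp_rw [← φ.symm.toEquiv.exists_congr_right (q := fun q => f _ = x ∧ f q = y ∧ _)]
      simp [φ.symm.map_adj_iff]
    · simp [← hφ, hroot]

theorem IsProperMinor.isIso_left (h : F.IsProperMinor R) (hF : F.IsIso T) : T.IsProperMinor R := by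
  cases h with
  | single h => exact .single (h.isIso_right hF)
  | tail h h' => exact h.tail (h'.isIso_right hF)

theorem IsProperMinor.isIso_right (h : F.IsProperMinor R) (hR : R.IsIso S) :
    F.IsProperMinor S := by
  obtain ⟨Q, h1, h2⟩ := Relation.TransGen.head'_iff.1 h
  exact Relation.TransGen.head'_iff.2 ⟨Q, h1.isIso_left hR, h2⟩

end Isomorphisms

/-! ### Minors of a root extension. -/

section ExtendRoot

variable {R S T F : RootedGraph.{u}}

/-- The inclusion of a rooted graph into its root extension. -/
def incl (S : RootedGraph.{u}) : S.V → S.extendRoot.V := some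

/-- The map on a root extension with given value at the root and given restriction. -/
def extendMap {α : Type*} (r : α) (g : S.V → α) : S.extendRoot.V → α := fun p => Option.elim p r g

@[simp] theorem extendMap_root {α : Type*} (r : α) (g : S.V → α) :
    extendMap r g S.extendRoot.root = r := rfl

@[simp] theorem extendMap_incl {α : Type*} (r : α) (g : S.V → α) (a : S.V) :
    extendMap r g (S.incl a) = g a := rfl

theorem incl_injective (S : RootedGraph.{u}) : Function.Injective S.incl := Option.some_injective _

@[simp] theorem incl_inj {a b : S.V} : S.incl a = S.incl b ↔ a = b := S.incl_injective.eq_iff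

@[simp] theorem incl_ne_root (a : S.V) : S.incl a ≠ S.extendRoot.root := Option.some_ne_none a

@[simp] theorem root_ne_incl (a : S.V) : S.extendRoot.root ≠ S.incl a := (incl_ne_root a).symm

theorem eq_root_or_incl (x : S.extendRoot.V) : x = S.extendRoot.root ∨ ∃ a, x = S.incl a :=
  match x with
  | none => Or.inl rfl
  | some a => Or.inr ⟨a, rfl⟩

@[simp] theorem extendRoot_adj_incl (a b : S.V) :
    S.extendRoot.graph.Adj (S.incl a) (S.incl b) ↔ S.graph.Adj a b := by
  change (S.graph.map some ⊔ SimpleGraph.edge none (some S.root)).Adj (some a) (some b) ↔ _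
  simpa [SimpleGraph.edge_adj, SimpleGraph.map_adj'] using fun h => h.ne

@[simp] theorem extendRoot_adj_root_incl (a : S.V) :
    S.extendRoot.graph.Adj S.extendRoot.root (S.incl a) ↔ a = S.root := by
  change (S.graph.map some ⊔ SimpleGraph.edge none (some S.root)).Adj none (some a) ↔ _
  simp [SimpleGraph.edge_adj, SimpleGraph.map_adj', eq_comm]

@[simp] theorem extendRoot_adj_incl_root (a : S.V) :
    S.extendRoot.graph.Adj (S.incl a) S.extendRoot.root ↔ a = S.root := by
  rw [SimpleGraph.adj_comm, extendRoot_adj_root_incl]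

/-- Recognition criterion: the root is a leaf, and the rest is a copy of `T` rooted at its neighbor.
-/
theorem isIso_extendRoot (g : T.V → F.V) (hinj : Function.Injective g)
    (hroot : ∀ x, x ≠ F.root ↔ ∃ a, g a = x)
    (hadj : ∀ a b, F.graph.Adj (g a) (g b) ↔ T.graph.Adj a b)
    (hnbr : ∀ a, F.graph.Adj F.root (g a) ↔ a = T.root) : F.IsIso T.extendRoot := by
  have hne : ∀ a, g a ≠ F.root := fun a => (hroot _).2 ⟨a, rfl⟩
  have hf : Function.Bijective (extendMap F.root g) := by
    constructor
    · intro p q hpq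
      obtain rfl | ⟨p, rfl⟩ := eq_root_or_incl p <;> obtain rfl | ⟨q, rfl⟩ := eq_root_or_incl q
      · rfl
      · exact absurd hpq.symm (hne q)
      · exact absurd hpq (hne p)
      · exact congrArg _ (hinj hpq)
    · intro x
      by_cases hx : x = F.root
      · exact ⟨T.extendRoot.root, hx.symm⟩
      · obtain ⟨a, ha⟩ := (hroot x).1 hx
        exact ⟨T.incl a, ha⟩
  refine IsIso.symm ⟨⟨Equiv.ofBijective _ hf, ?_⟩, rfl⟩
  intro p q
  rw [Equiv.ofBijective_apply, Equiv.ofBijective_apply]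
  obtain rfl | ⟨p, rfl⟩ := eq_root_or_incl p <;> obtain rfl | ⟨q, rfl⟩ := eq_root_or_incl q
  · simp
  · simp [hnbr]
  · simp [F.graph.adj_comm, hnbr]
  · simp [hadj]

theorem step_extendRoot_self (S : RootedGraph.{u}) : Step S.extendRoot S := by
  refine .contractEdge S.extendRoot.root (S.incl S.root) (by simp) (extendMap S.root id)
    (fun x => ⟨S.incl x, rfl⟩) ?_ ?_ rfl
  · intro x y
    obtain rfl | ⟨x, rfl⟩ := eq_root_or_incl x <;> obtain rfl | ⟨y, rfl⟩ := eq_root_or_incl y <;>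
      simp [eq_comm]
  · intro x y
    constructor
    · intro h
      exact ⟨h.ne, S.incl x, S.incl y, rfl, rfl, by simpa⟩
    · rintro ⟨hne, p, q, rfl, rfl, h⟩
      obtain rfl | ⟨p, rfl⟩ := eq_root_or_incl p <;> obtain rfl | ⟨q, rfl⟩ := eq_root_or_incl q
      · simp at h
      · simp_all
      · simp_all
      · simpa using h

theorem Step.extendRoot (h : Step S T) : Step S.extendRoot T.extendRoot := by
  classical
  cases h with
  | deleteEdge a b hab e he =>
    refine Step.isIso_right (S := ⟨S.extendRoot.V,
      S.extendRoot.graph.deleteEdges {s(S.incl a, S.incl b)}, S.extendRoot.root⟩)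
      (.deleteEdge (S.incl a) (S.incl b) (by simpa) .refl rfl)
      (isIso_extendRoot (fun t => S.incl (e t)) (fun x y h => by simpa using h) ?_ ?_ ?_)
    · intro x
      obtain rfl | ⟨x, rfl⟩ := eq_root_or_incl x
      · simp
      · simpa using e.surjective x
    · intro x y
      rw [← e.map_adj_iff]
      simp [SimpleGraph.deleteEdges_adj]
    · intro x
      simp [SimpleGraph.deleteEdges_adj, ← he]
  | deleteVertex v hv e he =>
    refine Step.isIso_right (S := ⟨{w | w ≠ S.incl v},
      S.extendRoot.graph.induce {w | w ≠ S.incl v}, ⟨S.extendRoot.root, by simp⟩⟩)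
      (.deleteVertex (S.incl v) (by simp) .refl rfl)
      (isIso_extendRoot (fun t => ⟨S.incl (e t), fun h => (e t).2 (S.incl_injective h)⟩)
        (fun x y h => e.injective (Subtype.ext (S.incl_injective (congrArg Subtype.val h)))) ?_ ?_ ?_)
    · rintro ⟨x, hx⟩
      obtain rfl | ⟨x, rfl⟩ := eq_root_or_incl x
      · simp
      · obtain ⟨t, ht⟩ := e.surjective ⟨x, by simpa using hx⟩
        simp only [ne_eq, Subtype.mk.injEq, incl_ne_root, not_false_eq_true, true_iff]
        exact ⟨t, by simp [ht]⟩
    · intro x y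
      rw [← e.map_adj_iff]
      simp
    · intro x
      simp [← he, Subtype.val_inj]
  | contractEdge a b hab f hf hfib hadj hroot =>
    refine .contractEdge (S.incl a) (S.incl b) (by simpa) (extendMap T.extendRoot.root (T.incl ∘ f))
      ?_ ?_ ?_ rfl
    · intro x
      obtain rfl | ⟨x, rfl⟩ := eq_root_or_incl x
      · exact ⟨S.extendRoot.root, rfl⟩
      · obtain ⟨y, rfl⟩ := hf x
        exact ⟨S.incl y, rfl⟩
    · intro x y
      obtain rfl | ⟨x, rfl⟩ := eq_root_or_incl x <;> obtain rfl | ⟨y, rfl⟩ := eq_root_or_incl y <;>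
        simp [hfib]
    · intro x y
      constructor
      · intro h
        refine ⟨h.ne, ?_⟩
        obtain rfl | ⟨x, rfl⟩ := eq_root_or_incl x <;> obtain rfl | ⟨y, rfl⟩ := eq_root_or_incl y
        · simp at h
        · obtain rfl : y = T.root := by simpa using h
          exact ⟨S.extendRoot.root, S.incl S.root, rfl, by simp [hroot], by simp⟩
        · obtain rfl : x = T.root := by simpa using h
          exact ⟨S.incl S.root, S.extendRoot.root, by simp [hroot], rfl, by simp⟩
        · obtain ⟨-, p, q, rfl, rfl, hpq⟩ := (hadj x y).1 (by simpa using h)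
          exact ⟨S.incl p, S.incl q, rfl, rfl, by simpa⟩
      · rintro ⟨hne, p, q, rfl, rfl, h⟩
        obtain rfl | ⟨p, rfl⟩ := eq_root_or_incl p <;> obtain rfl | ⟨q, rfl⟩ := eq_root_or_incl q
        · simp at h
        · obtain rfl : q = S.root := by simpa using h
          simp [hroot]
        · obtain rfl : p = S.root := by simpa using h
          simp [hroot]
        · simp only [extendMap_incl, Function.comp_apply, extendRoot_adj_incl, ne_eq,
            incl_inj] at hne h ⊢
          exact (hadj _ _).2 ⟨hne, p, q, rfl, rfl, h⟩

/-- The root has no neighbors. -/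
def IsRootIsolated (R : RootedGraph.{u}) : Prop := ∀ v, ¬ R.graph.Adj R.root v

theorem Step.isRootIsolated (h : Step R S) (hR : R.IsRootIsolated) : S.IsRootIsolated := by
  intro v hv
  cases h with
  | deleteEdge a b hab e he =>
    rw [← e.map_adj_iff, he, SimpleGraph.deleteEdges_adj] at hv
    exact hR _ hv.1
  | deleteVertex w hw e he =>
    rw [← e.map_adj_iff, SimpleGraph.induce_adj, he] at hv
    exact hR _ hv
  | contractEdge a b hab f hf hfib hadj hroot =>
    obtain ⟨-, p, q, hp, -, hpq⟩ := (hadj _ _).1 hv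
    rw [← hroot, hfib] at hp
    obtain rfl | ⟨rfl, rfl⟩ | ⟨rfl, rfl⟩ := hp
    · exact hR _ hpq
    · exact hR _ hab.symm
    · exact hR _ hab

/-- An operation sparing the pendant edge and its inner end comes from `S`, and so does contracting
another edge at that end. Contracting the pendant edge returns `S`; deleting it, or its inner end,
isolates the root. -/
theorem Step.of_extendRoot (h : Step S.extendRoot F) :
    (∃ T, Step S T ∧ F.IsIso T.extendRoot) ∨ F.IsIso S ∨ F.IsRootIsolated := by
  classical
  cases h with
  | deleteEdge a b hab e he =>
    have hiso : s(S.extendRoot.root, S.incl S.root) = s(a, b) → F.IsRootIsolated := by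
      intro h v hv
      rw [← e.map_adj_iff, he, SimpleGraph.deleteEdges_adj] at hv
      obtain hx | ⟨x, hx⟩ := eq_root_or_incl (e v)
      · simp [hx] at hv
      · rw [hx] at hv
        obtain rfl : x = S.root := by simpa using hv.1
        exact hv.2 h
    obtain rfl | ⟨a, rfl⟩ := eq_root_or_incl a <;> obtain rfl | ⟨b, rfl⟩ := eq_root_or_incl b
    · simp at hab
    · exact Or.inr (Or.inr (hiso (by simp_all)))
    · exact Or.inr (Or.inr (hiso (by simp_all)))
    · refine Or.inl ⟨⟨S.V, S.graph.deleteEdges {s(a, b)}, S.root⟩,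
        .deleteEdge a b (by simpa using hab) .refl rfl,
        isIso_extendRoot (fun t => e.symm (S.incl t)) (fun x y h => by simpa using h) ?_ ?_ ?_⟩
      · intro x
        obtain ⟨x, rfl⟩ := e.symm.surjective x
        have hr : e.symm S.extendRoot.root = F.root := by rw [← he, e.symm_apply_apply]
        rw [← hr, e.symm.injective.ne_iff]
        obtain rfl | ⟨x, rfl⟩ := eq_root_or_incl x <;> simp
      · intro x y
        rw [e.symm.map_adj_iff]
        simp [SimpleGraph.deleteEdges_adj]
      · intro x
        rw [← e.map_adj_iff]
        simp [he, SimpleGraph.deleteEdges_adj]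
  | deleteVertex v hv e he =>
    obtain rfl | ⟨v, rfl⟩ := eq_root_or_incl v
    · exact absurd rfl hv
    by_cases hvr : v = S.root
    · refine Or.inr (Or.inr fun x hx => ?_)
      rw [← e.map_adj_iff, SimpleGraph.induce_adj, he] at hx
      have := (e x).2
      obtain h | ⟨y, h⟩ := eq_root_or_incl (e x).1
      · simp [h] at hx
      · simp_all
    · let g : {w | w ≠ v} → {w | w ≠ S.incl v} := fun t => ⟨S.incl t, fun h => t.2 (S.incl_injective h)⟩
      have hg : ∀ t, (g t : S.extendRoot.V) = S.incl t := fun _ => rfl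
      refine Or.inl ⟨⟨{w | w ≠ v}, S.graph.induce {w | w ≠ v}, ⟨S.root, Ne.symm hvr⟩⟩,
        .deleteVertex v hvr .refl rfl,
        isIso_extendRoot (fun t => e.symm (g t)) ?_ ?_ ?_ ?_⟩
      · intro x y h
        exact Subtype.ext (S.incl_injective (congrArg Subtype.val (e.symm.injective h)))
      · intro x
        obtain ⟨⟨x, hx⟩, rfl⟩ := e.symm.surjective x
        rw [← e.injective.ne_iff, e.apply_symm_apply, ← Subtype.coe_injective.ne_iff, he]
        simp only [e.symm.injective.eq_iff, Subtype.ext_iff, hg]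
        obtain rfl | ⟨x, rfl⟩ := eq_root_or_incl x
        · simp
        · simpa using hx
      · intro x y
        rw [e.symm.map_adj_iff]
        simp [hg]
      · intro x
        rw [← e.map_adj_iff]
        simp [he, hg, Subtype.ext_iff]
  | contractEdge a b hab f hf hfib hadj hroot =>
    have hiso : (∀ x y, f x = f y ↔ x = y ∨ (x = S.extendRoot.root ∧ y = S.incl S.root) ∨
        (x = S.incl S.root ∧ y = S.extendRoot.root)) → F.IsIso S := by
      intro hfib
      have hinj : Function.Injective fun x => f (S.incl x) := fun x y h => by simpa using (hfib _ _).1 h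
      have hr : f (S.incl S.root) = F.root := by rw [← hroot, hfib]; simp
      refine IsIso.symm ⟨⟨Equiv.ofBijective (fun x => f (S.incl x)) ⟨hinj, fun x => ?_⟩, ?_⟩, hr⟩
      · obtain ⟨x, rfl⟩ := hf x
        obtain rfl | ⟨x, rfl⟩ := eq_root_or_incl x
        · exact ⟨S.root, hr.trans hroot.symm⟩
        · exact ⟨x, rfl⟩
      · intro x y
        refine (hadj (f (S.incl x)) (f (S.incl y))).trans ?_
        constructor
        · rintro ⟨hne, p, q, hp, hq, hpq⟩
          rw [hfib] at hp hq
          obtain rfl | ⟨p, rfl⟩ := eq_root_or_incl p <;> obtain rfl | ⟨q, rfl⟩ := eq_root_or_incl q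
          · simp at hpq
          · simp_all
          · simp_all
          · simp_all
        · intro h
          exact ⟨hinj.ne h.ne, S.incl x, S.incl y, rfl, rfl, by simpa⟩
    obtain rfl | ⟨a, rfl⟩ := eq_root_or_incl a <;> obtain rfl | ⟨b, rfl⟩ := eq_root_or_incl b
    · simp at hab
    · obtain rfl : b = S.root := by simpa using hab
      exact Or.inr (Or.inl (hiso hfib))
    · obtain rfl : a = S.root := by simpa using hab
      exact Or.inr (Or.inl (hiso fun x y => by rw [hfib, or_comm (a := x = _ ∧ _)]))
    · have hne : ∀ x, f (S.incl x) ≠ F.root := fun x h => by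
        rw [← hroot, hfib] at h
        simp at h
      -- The contraction of `S` is recovered as `F` without its root, rooted at the image of the old
      -- root.
      refine Or.inl ⟨⟨{x // x ≠ F.root}, F.graph.induce {x | x ≠ F.root},
        ⟨f (S.incl S.root), hne _⟩⟩, .contractEdge a b (by simpa using hab)
          (fun x => ⟨f (S.incl x), hne x⟩) ?_ ?_ ?_ rfl,
        isIso_extendRoot Subtype.val Subtype.val_injective (by simp) (fun _ _ => Iff.rfl) ?_⟩
      · rintro ⟨x, hx⟩
        obtain ⟨x, rfl⟩ := hf x
        obtain rfl | ⟨x, rfl⟩ := eq_root_or_incl x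
        · exact absurd hroot hx
        · exact ⟨x, rfl⟩
      · intro x y
        simp [hfib]
      · rintro ⟨x, hx⟩ ⟨y, hy⟩
        simp only [SimpleGraph.induce_adj, Subtype.mk.injEq, ne_eq, hadj]
        refine and_congr_right fun _ => ⟨?_, ?_⟩
        · rintro ⟨p, q, rfl, rfl, hpq⟩
          obtain rfl | ⟨p, rfl⟩ := eq_root_or_incl p
          · exact absurd hroot hx
          obtain rfl | ⟨q, rfl⟩ := eq_root_or_incl q
          · exact absurd hroot hy
          exact ⟨p, q, rfl, rfl, by simpa using hpq⟩
        · rintro ⟨p, q, rfl, rfl, hpq⟩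
          exact ⟨S.incl p, S.incl q, rfl, rfl, by simpa⟩
      · rintro ⟨x, hx⟩
        simp only [hadj, Subtype.mk.injEq]
        constructor
        · rintro ⟨-, p, q, hp, rfl, hpq⟩
          obtain rfl | ⟨p, rfl⟩ := eq_root_or_incl p
          · obtain rfl | ⟨q, rfl⟩ := eq_root_or_incl q
            · exact absurd hroot hx
            · rw [show q = S.root by simpa using hpq]
          · exact absurd hp (hne p)
        · rintro rfl
          exact ⟨hx.symm, S.extendRoot.root, S.incl S.root, hroot, rfl, by simp⟩

/-- The last two outcomes persist under further operations, so the one-step trichotomy propagates.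
-/
theorem IsProperMinor.of_extendRoot {S F : RootedGraph.{u}} (h : F.IsProperMinor S.extendRoot) :
    (∃ T : RootedGraph.{u}, T.IsProperMinor S ∧ F.IsIso T.extendRoot) ∨
      (∃ T, Relation.ReflTransGen Step S T ∧ F.IsIso T) ∨ F.IsRootIsolated := by
  induction h with
  | single h =>
    obtain ⟨T, hT, hF⟩ | hF | hF := h.of_extendRoot
    · exact Or.inl ⟨T, .single hT, hF⟩
    · exact Or.inr (Or.inl ⟨S, .refl, hF⟩)
    · exact Or.inr (Or.inr hF)
  | tail _ h ih =>
    obtain ⟨T, hT, hF⟩ | ⟨T, hT, hF⟩ | hF := ih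
    · obtain ⟨T', hT', hF'⟩ | hF' | hF' := (h.isIso_left hF).of_extendRoot
      · exact Or.inl ⟨T', hT.tail hT', hF'⟩
      · exact Or.inr (Or.inl ⟨T, hT.to_reflTransGen, hF'⟩)
      · exact Or.inr (Or.inr hF')
    · exact Or.inr (Or.inl ⟨_, hT.tail (h.isIso_left hF), .refl _⟩)
    · exact Or.inr (Or.inr (h.isRootIsolated hF))

theorem IsProperMinor.extendRoot (h : T.IsProperMinor S) :
    T.extendRoot.IsProperMinor S.extendRoot :=
  Relation.TransGen.lift (p := Step) RootedGraph.extendRoot (fun _ _ h => Step.extendRoot h) _ _ h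

end ExtendRoot

end RootedGraph

/-! ### Values of `ξξ`, minors realizing them, and the main theorem. -/

namespace RootedGraph

variable {R S T F : RootedGraph.{u}} {k l : ℕ}

open scoped Classical in
theorem rootSplit (R : RootedGraph.{u}) :
    RootSplit R.graph R.root (R.graph.induce {v | v ≠ R.root}) {w | R.graph.Adj R.root w}
      (Equiv.optionSubtypeNe R.root).symm := by
  have h : ∀ v : {v // v ≠ R.root}, (Equiv.optionSubtypeNe R.root).symm.symm (some v) = v :=
    Equiv.optionSubtypeNe_some R.root
  refine ⟨Equiv.optionSubtypeNe_symm_self R.root, fun a b => ?_, fun a => ?_⟩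
  · rw [h a, h b]
    rfl
  · rw [h a]
    rfl

theorem extendRoot_rootSplit (S : RootedGraph.{u}) :
    RootSplit S.extendRoot.graph S.extendRoot.root S.graph {S.root} (Equiv.refl (Option S.V)) :=
  ⟨rfl, fun a b => (extendRoot_adj_incl a b).symm, fun a => (extendRoot_adj_root_incl a).symm⟩

theorem AllowsSNIP.le_succ (h : R.AllowsSNIP k l) : l ≤ k + 1 := by
  classical
  obtain ⟨a, b, C, hC, -, rfl, rfl, -⟩ := (allowsSNIP_iff R.rootSplit k l).1 h
  exact nullity_le_nullity_border_add_one hC.1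

theorem AllowsSNIP.step_down (h : R.AllowsSNIP (k + 1) (k + 1)) : R.AllowsSNIP k (k + 1) := by
  classical
  rw [allowsSNIP_iff R.rootSplit] at h ⊢
  exact h.step_down

theorem allowsSNIP_self_iff : R.AllowsSNIP k k ↔ ∃ A, IsGraphMatrix R.graph A ∧ HasSAP R.graph A ∧
    nullity A = k + 1 ∧ ∃ x, A *ᵥ x = 0 ∧ x R.root ≠ 0 := by
  classical
  rw [allowsSNIP_iff R.rootSplit, R.rootSplit.allowsBorder_self_iff]

/-- Both sides ask for a SAP matrix of `S` of nullity `k + 1` with a kernel vector nonzero at the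
root of `S`, which is the only neighbor of the new root. -/
theorem extendRoot_allowsSNIP_succ_iff : S.extendRoot.AllowsSNIP k (k + 1) ↔ S.AllowsSNIP k k := by
  rw [allowsSNIP_iff S.extendRoot_rootSplit, allowsBorder_succ_iff, allowsSNIP_self_iff]
  simp

theorem IsIso.allowsSNIP_iff (h : R.IsIso S) : R.AllowsSNIP k l ↔ S.AllowsSNIP k l := by
  classical
  obtain ⟨φ, hφ⟩ := h
  have hs := S.rootSplit
  have h : ∀ x, φ ((φ.toEquiv.trans (Equiv.optionSubtypeNe S.root).symm).symm x) =
      (Equiv.optionSubtypeNe S.root).symm.symm x := fun x => φ.apply_symm_apply _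
  rw [RootedGraph.allowsSNIP_iff hs, RootedGraph.allowsSNIP_iff (R := R)
    (e := φ.toEquiv.trans (Equiv.optionSubtypeNe S.root).symm) ⟨?_, fun a b => ?_, fun a => ?_⟩]
  · exact (congrArg _ hφ).trans hs.map_root
  · rw [hs.adj_iff, ← φ.map_adj_iff, h, h]
  · rw [hs.mem_iff, ← φ.map_adj_iff, hφ, h]

theorem le_xixi (hkl : k ≤ l) (h : R.AllowsSNIP k l) : k + l ≤ R.xixi :=
  R.isGreatest_xixi.2 ⟨k, l, hkl, h, rfl⟩

theorem two_mul_add_one_le_xixi_iff :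
    2 * k + 1 ≤ R.xixi ↔ ∃ m, k ≤ m ∧ R.AllowsSNIP m (m + 1) := by
  constructor
  · intro h
    obtain ⟨p, q, hpq, hR, hs⟩ := R.isGreatest_xixi.1
    obtain rfl | hlt := hpq.eq_or_lt
    -- An even sum that is at least `2 * k + 1` is at least `2 * k + 2`, which leaves room to step
    -- down once.
    · obtain ⟨p, rfl⟩ : ∃ m, p = m + 1 := ⟨p - 1, by omega⟩
      exact ⟨p, by omega, hR.step_down⟩
    · have := hR.le_succ
      obtain rfl : q = p + 1 := by omega
      exact ⟨p, by omega, hR⟩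
  · rintro ⟨m, hm, h⟩
    have := le_xixi (Nat.le_succ m) h
    omega

theorem allowsSNIP_of_two_mul_le_xixi (h : 2 * k ≤ R.xixi) :
    ∃ m, k ≤ m ∧ (R.AllowsSNIP m m ∨ R.AllowsSNIP m (m + 1)) := by
  obtain ⟨p, q, hpq, hR, hs⟩ := R.isGreatest_xixi.1
  have := hR.le_succ
  obtain rfl | rfl : q = p ∨ q = p + 1 := by omega
  · exact ⟨q, by omega, Or.inl hR⟩
  · exact ⟨p, by omega, Or.inr hR⟩

theorem IsRootIsolated.not_allowsSNIP (hR : R.IsRootIsolated) : ¬ R.AllowsSNIP k (k + 1) := by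
  classical
  rw [allowsSNIP_iff R.rootSplit, allowsBorder_succ_iff]
  rintro ⟨C, -, -, -, w, -, j, hj, -⟩
  exact hR _ hj

theorem reflTransGen_step_of_le (R : RootedGraph.{u}) {G : SimpleGraph R.V} (h : G ≤ R.graph) :
    Relation.ReflTransGen Step R { R with graph := G } := by
  obtain ⟨V, H, r⟩ := R
  simp only at G h ⊢
  induction H using WellFoundedLT.induction with
  | ind H ih =>
    by_cases hGH : H ≤ G
    · obtain rfl : G = H := le_antisymm h hGH
      exact .refl
    · obtain ⟨a, b, hab, hG⟩ : ∃ a b, H.Adj a b ∧ ¬ G.Adj a b := by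
        by_contra! hcon
        exact hGH fun a b => hcon a b
      have hle : G ≤ H.deleteEdges {s(a, b)} := by
        intro x y hxy
        rw [SimpleGraph.deleteEdges_adj]
        refine ⟨h hxy, fun he => hG ?_⟩
        rw [Set.mem_singleton_iff] at he
        rw [← SimpleGraph.mem_edgeSet, ← he]
        exact hxy
      have hlt : H.deleteEdges {s(a, b)} < H := by
        refine lt_of_le_of_ne (SimpleGraph.deleteEdges_le _) fun he => ?_
        have := he ▸ hab
        simp [SimpleGraph.deleteEdges_adj] at this
      exact (ih _ hlt hle).head (.deleteEdge a b hab .refl rfl)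

/-- The kernel vector is nonzero at one neighbor `j`. Deleting all other root edges leaves the
extension of the rootless graph, now rooted at `j`, and the same matrix `C` witnesses `(k, k)`
there. -/
theorem AllowsSNIP.exists_extendRoot (h : R.AllowsSNIP k (k + 1)) :
    ∃ S : RootedGraph.{u}, S.AllowsSNIP k k ∧
      (R.IsIso S.extendRoot ∨ S.extendRoot.IsProperMinor R) := by
  classical
  rw [allowsSNIP_iff R.rootSplit, allowsBorder_succ_iff] at h
  obtain ⟨C, hC, hS, hn, w, hw, j, hj, hwj⟩ := h
  let G : SimpleGraph R.V := R.graph.deleteEdges {e | R.root ∈ e ∧ e ≠ s(R.root, ↑j)}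
  let R' : RootedGraph.{u} := { R with graph := G }
  let S : RootedGraph.{u} := ⟨{v // v ≠ R.root}, R.graph.induce {v | v ≠ R.root}, j⟩
  have hj : R.graph.Adj R.root j := hj
  have hiso : R'.IsIso S.extendRoot := by
    refine isIso_extendRoot (T := S) (F := R') Subtype.val Subtype.val_injective ?_ ?_ ?_
    · intro x
      simp [R', S]
    · rintro ⟨a, ha⟩ ⟨b, hb⟩
      simp [R', S, G, SimpleGraph.deleteEdges_adj, ha.symm, hb.symm]
    · rintro ⟨a, ha⟩
      change G.Adj R.root a ↔ (⟨a, ha⟩ : {v // v ≠ R.root}) = j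
      rw [Subtype.ext_iff, SimpleGraph.deleteEdges_adj]
      constructor
      · rintro ⟨-, h⟩
        simpa [ha] using h
      · intro h
        obtain rfl : a = j := h
        exact ⟨hj, by simp⟩
  refine ⟨S, allowsSNIP_self_iff.2 ⟨C, hC, hS, hn, w, hw, hwj⟩, ?_⟩
  obtain heq | h := Relation.reflTransGen_iff_eq_or_transGen.1
    (R.reflTransGen_step_of_le (SimpleGraph.deleteEdges_le _ : G ≤ R.graph))
  · exact Or.inl (heq ▸ hiso)
  · exact Or.inr (IsProperMinor.isIso_left h hiso)

theorem AllowsSNIP.exists_isProperMinor (h : R.AllowsSNIP k (k + 1)) :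
    ∃ S : RootedGraph.{u}, S.IsProperMinor R ∧ S.AllowsSNIP k k := by
  obtain ⟨S, hS, hR⟩ := h.exists_extendRoot
  refine ⟨S, ?_, hS⟩
  have hstep := step_extendRoot_self S
  obtain hR | hR := hR
  · exact .single (hstep.isIso_left hR.symm)
  · exact Relation.TransGen.tail hR hstep

/-- Stands in for minor monotonicity: at the price of passing to a minor, the pair may be taken with
equal entries. -/
theorem exists_isMinor_of_two_mul_le_xixi (h : 2 * k ≤ R.xixi) :
    ∃ m S, k ≤ m ∧ Relation.ReflTransGen Step R S ∧ S.AllowsSNIP m m := by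
  obtain ⟨m, hm, hR | hR⟩ := allowsSNIP_of_two_mul_le_xixi h
  · exact ⟨m, R, hm, .refl, hR⟩
  · obtain ⟨S, hS, hSm⟩ := hR.exists_isProperMinor
    exact ⟨m, S, hm, hS.to_reflTransGen, hSm⟩

end RootedGraph

open RootedGraph in
theorem mainTheorem3 (k : ℕ) (R : RootedGraph.{u}) :
    R.IsMinimalMinor (2 * k + 1) ↔
      ∃ S : RootedGraph.{u}, S.IsMinimalMinor (2 * k) ∧ R.IsIso S.extendRoot := by
  constructor
  · rintro ⟨hR, hmin⟩
    obtain ⟨m, hm, hRm⟩ := two_mul_add_one_le_xixi_iff.1 hR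
    obtain ⟨S, hS, hiso | hprop⟩ := hRm.exists_extendRoot
    · refine ⟨S, ⟨(by omega : 2 * k ≤ m + m).trans (le_xixi le_rfl hS), fun T hT => ?_⟩, hiso⟩
      by_contra! hcon
      -- The extension of such a `Q` would be a proper minor of `R` with `ξξ ≥ 2 * k + 1`.
      obtain ⟨p, Q, hp, hTQ, hQ⟩ := exists_isMinor_of_two_mul_le_xixi hcon
      have hQS : Q.IsProperMinor S := Relation.TransGen.trans_left hT hTQ
      have hlt := hmin _ (hQS.extendRoot.isIso_right hiso.symm)
      have := two_mul_add_one_le_xixi_iff.2 ⟨p, hp, extendRoot_allowsSNIP_succ_iff.2 hQ⟩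
      omega
    · have hlt := hmin _ hprop
      have := two_mul_add_one_le_xixi_iff.2 ⟨m, hm, extendRoot_allowsSNIP_succ_iff.2 hS⟩
      omega
  · rintro ⟨S, ⟨hS, hmin⟩, hiso⟩
    have key : ∀ (m : ℕ) (T : RootedGraph.{u}), k ≤ m → T.IsProperMinor S → ¬ T.AllowsSNIP m m := fun m (T : RootedGraph.{u}) hm hT h => by
      have := hmin T hT
      have := le_xixi le_rfl h
      omega
    constructor
    · rw [two_mul_add_one_le_xixi_iff]
      obtain ⟨m, hm, hSm | hSm⟩ := allowsSNIP_of_two_mul_le_xixi hS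
      · exact ⟨m, hm, hiso.allowsSNIP_iff.2 (extendRoot_allowsSNIP_succ_iff.2 hSm)⟩
      -- A minimal `S` cannot realize its value by a pair `(m, m + 1)`, since a proper minor would
      -- then allow `(m, m)`.
      · obtain ⟨T, hT, hTm⟩ := hSm.exists_isProperMinor
        exact absurd hTm (key m T hm hT)
    · intro F hF
      by_contra! hcon
      obtain ⟨m, hm, hFm⟩ := two_mul_add_one_le_xixi_iff.1 hcon
      obtain ⟨T, hT, hFT⟩ | ⟨T, hT, hFT⟩ | hF' := (hF.isIso_right hiso).of_extendRoot
      · exact key m T hm hT (extendRoot_allowsSNIP_succ_iff.1 (hFT.allowsSNIP_iff.1 hFm))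
      · obtain ⟨Q, hQ, hQm⟩ := (hFT.allowsSNIP_iff.1 hFm).exists_isProperMinor
        exact key m Q hm (Relation.TransGen.trans_right hT hQ) hQm
      · exact hF'.not_allowsSNIP hFm
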